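/- Let $\mu>0$, $L>0$, and let $\varepsilon:[0,L]\to(0,\infty)$ be continuously differentiable. Put $c(x)=1/\sqrt{\varepsilon(x)\mu}$ and $\xi(x)=\sqrt{\mu}\int_0^x\sqrt{\varepsilon(s)}\,ds$; for a function $g$ of $x\in[0,L]$ let $\widetilde g$ be the same function in terms of $\xi\in[0,\xi(L)]$, i.e. $\widetilde g(\xi(x))=g(x)$, and let $f(\xi)=\sqrt{\widetilde c(0)}/\sqrt{\widetilde c(\xi)}$. Define $X^{(0)}=\widetilde X^{(0)}\equiv 1$ and, for $n\ge 1$, $$X^{(n)}(\xi)=n\int_0^\xi X^{(n-1)}(s)\,(f^2(s))^{(-1)^n}ds,\qquad \widetilde X^{(n)}(\xi)=n\int_0^\xi \widetilde X^{(n-1)}(s)\,(f^2(s))^{(-1)^{n-1}}ds,$$ $\varphi_k=fX^{(k)}$, $\psi_k=\widetilde X^{(k)}/f$ for odd $k$, $\varphi_k=f\widetilde X^{(k)}$, $\psi_k=X^{(k)}/f$ for even $k$, and, for $0<\xi\le\xi(L)$, $$a_n(\xi)=\frac{2n+1}{2}\Bigl(\sum_{k=0}^n\frac{l_{k,n}\varphi_k(\xi)}{\xi^k}-1\Bigr),\qquad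 b_n(\xi)=\frac{2n+1}{2}\Bigl(\sum_{k=0}^n\frac{l_{k,n}\psi_k(\xi)}{\xi^k}-1\Bigr),$$ where $P_n(x)=\sum_{k=0}^n l_{k,n}x^k$ is the Legendre polynomial of degree $n$. Let $j_n$ be the spherical Bessel function of the first kind of order $n$. Let $I\subseteq\mathbb R$ be an interval (for example $[t_0,t_1]$ or $\mathbb R$), let $M\ge 0$ be an integer, $\omega_0,\omega\in\mathbb C$, $\alpha_m,\beta_m\in\mathbb C$ for $-M\le m\le M$, and set $$c_m^{\pm}=\sqrt{c(0)}\bigl(\sqrt{\varepsilon(0)}\,\alpha_m\pm i\sqrt{\mu}\,\beta_m\bigr).$$ Consider the problem $$\varepsilon(x)\partial_t\mathcal E=i\partial_x\mathcal H,\qquad i\partial_x\mathcal E=-\mu\,\partial_t\mathcal H,$$ $$\mathcal E(0,t)=\sum_{m=-M}^M\alpha_m e^{i(\omega_0+m\omega)t},\qquad \mathcal H(0,t)=\sum_{m=-M}^M\beta_m e^{i(\omega_0+m\omega)t}\qquad(t\in I)$$ on the domain of determinacy $D=\{(x,t):0\le x\le L,\ [t-\xi(x),t+\xi(x)]\subseteq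 I\}$, for complex-valued functions $\mathcal E,\mathcal H$ that are continuous on $D$, continuously differentiable in its interior and satisfy the system there. Then the problem has a solution, the solution is unique on $D$, and, written in the coordinates $\xi,t$, it is given for all $0<\xi\le\xi(L)$ and all $t$ with $[t-\xi,t+\xi]\subseteq I$ by $$\widetilde{\mathcal E}(\xi,t)=\frac{1}{\sqrt{\widetilde c(\xi)\widetilde\varepsilon(\xi)}}\sum_{m=-M}^{M}e^{i(\omega_0+m\omega)t}\Bigl(\frac{c_m^+}{2}e^{i(\omega_0+m\omega)\xi}+\frac{c_m^-}{2}e^{-i(\omega_0+m\omega)\xi}+c_m^+\sum_{n=0}^\infty a_n(\xi)e^{\frac{n\pi i}{2}}j_n((\omega_0+m\omega)\xi)+c_m^-\sum_{n=0}^\infty(-1)^n a_n(\xi)e^{\frac{n\pi i}{2}}j_n((\omega_0+m\omega)\xi)\Bigr),$$ $$\widetilde{\mathcal H}(\xi,t)=-\frac{i}{\sqrt{\widetilde c(\xi)\mu}}\sum_{m=-M}^{M}e^{i(\omega_0+m\omega)t}\Bigl(\frac{c_m^+}{2}e^{i(\omega_0+m\omega)\xi}-\frac{c_m^-}{2}e^{-i(\omega_0+m\omega)\xi}+c_m^+\sum_{n=0}^\infty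 b_n(\xi)e^{\frac{n\pi i}{2}}j_n((\omega_0+m\omega)\xi)-c_m^-\sum_{n=0}^\infty(-1)^n b_n(\xi)e^{\frac{n\pi i}{2}}j_n((\omega_0+m\omega)\xi)\Bigr),$$ where all the series converge absolutely. -/

import Mathlib

noncomputable section

namespace MaxwellNSBF

/-- The Legendre polynomial `P_n`, by Rodrigues' formula. -/
def legendre (n : ℕ) : Polynomial ℝ :=
  Polynomial.C ((2 ^ n * (n.factorial : ℝ))⁻¹) *
    Polynomial.derivative^[n] ((Polynomial.X ^ 2 - 1) ^ n)

/-- The spherical Bessel function of the first kind of order `n`, an entire function: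
`j_n(z) = z ^ n * ∑ k, (-z² / 2) ^ k / (k! (2n + 2k + 1)!!)`. -/
def sphericalBesselJ (n : ℕ) (z : ℂ) : ℂ :=
  z ^ n * ∑' k : ℕ, (-(z ^ 2 / 2)) ^ k /
    ((k.factorial : ℂ) * ((2 * n + 2 * k + 1).doubleFactorial : ℂ))

/-- The recursive integrals `X⁽ⁿ⁾` built from `f`. -/
def X (f : ℝ → ℝ) : ℕ → ℝ → ℝ
  | 0 => fun _ => 1
  | n + 1 => fun ξ =>
      ((n + 1 : ℕ) : ℝ) * ∫ s in (0 : ℝ)..ξ, X f n s * (f s ^ 2) ^ ((-1 : ℤ) ^ (n + 1))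

/-- The recursive integrals `X̃⁽ⁿ⁾` built from `f`. -/
def Xtilde (f : ℝ → ℝ) : ℕ → ℝ → ℝ
  | 0 => fun _ => 1
  | n + 1 => fun ξ =>
      ((n + 1 : ℕ) : ℝ) * ∫ s in (0 : ℝ)..ξ, Xtilde f n s * (f s ^ 2) ^ ((-1 : ℤ) ^ n)

/-- The functions `φ_k`. -/
def phi (f : ℝ → ℝ) (k : ℕ) (ξ : ℝ) : ℝ :=
  if Odd k then f ξ * X f k ξ else f ξ * Xtilde f k ξ

/-- The functions `ψ_k`. -/
def psi (f : ℝ → ℝ) (k : ℕ) (ξ : ℝ) : ℝ :=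
  if Odd k then Xtilde f k ξ / f ξ else X f k ξ / f ξ

/-- The coefficients `a_n`; `(legendre n).coeff k` is `l_{k,n}`. -/
def coeffA (f : ℝ → ℝ) (n : ℕ) (ξ : ℝ) : ℝ :=
  (2 * (n : ℝ) + 1) / 2 *
    (∑ k ∈ Finset.range (n + 1), (legendre n).coeff k * phi f k ξ / ξ ^ k - 1)

/-- The coefficients `b_n`. -/
def coeffB (f : ℝ → ℝ) (n : ℕ) (ξ : ℝ) : ℝ :=
  (2 * (n : ℝ) + 1) / 2 *
    (∑ k ∈ Finset.range (n + 1), (legendre n).coeff k * psi f k ξ / ξ ^ k - 1)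

/-- The wave speed `c(x) = 1 / √(ε(x) μ)`. -/
def speed (μ : ℝ) (ε : ℝ → ℝ) (x : ℝ) : ℝ := 1 / √(ε x * μ)

/-- The new variable `ξ(x) = √μ ∫₀ˣ √ε(s) ds`. -/
def xiOf (μ : ℝ) (ε : ℝ → ℝ) (x : ℝ) : ℝ := √μ * ∫ s in (0 : ℝ)..x, √(ε s)

/-- A function `g` of `x ∈ [0, L]` written as a function of `ξ ∈ [0, ξ(L)]`: the function `g̃`
with `g̃(ξ(x)) = g(x)`. -/
def tilde (μ : ℝ) (ε : ℝ → ℝ) (L : ℝ) {α : Type*} (g : ℝ → α) (ξ : ℝ) : α :=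
  g (Function.invFunOn (xiOf μ ε) (Set.Icc 0 L) ξ)

/-- `f(ξ) = √c̃(0) / √c̃(ξ)`. -/
def profile (μ : ℝ) (ε : ℝ → ℝ) (L : ℝ) (ξ : ℝ) : ℝ :=
  √(tilde μ ε L (speed μ ε) 0) / √(tilde μ ε L (speed μ ε) ξ)

/-- The domain of determinacy of the data on `{0} × I`: the points `(x, t)`, `0 ≤ x ≤ L`, both of
whose characteristics meet the line `x = 0` in `I` and enclose only times in `I`. -/
def domain (μ : ℝ) (ε : ℝ → ℝ) (L : ℝ) (I : Set ℝ) : Set (ℝ × ℝ) :=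
  {p | p.1 ∈ Set.Icc 0 L ∧ Set.Icc (p.2 - xiOf μ ε p.1) (p.2 + xiOf μ ε p.1) ⊆ I}

/-- `(E, H)` is a classical solution of the 1+1 Maxwell system with data `E₀, H₀` at `x = 0`. -/
structure IsSolution (μ : ℝ) (ε : ℝ → ℝ) (L : ℝ) (I : Set ℝ) (E₀ H₀ : ℝ → ℂ)
    (E H : ℝ → ℝ → ℂ) : Prop where
  continuousOn_E : ContinuousOn (fun p : ℝ × ℝ => E p.1 p.2) (domain μ ε L I)
  continuousOn_H : ContinuousOn (fun p : ℝ × ℝ => H p.1 p.2) (domain μ ε L I)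
  contDiffOn_E : ContDiffOn ℝ 1 (fun p : ℝ × ℝ => E p.1 p.2) (interior (domain μ ε L I))
  contDiffOn_H : ContDiffOn ℝ 1 (fun p : ℝ × ℝ => H p.1 p.2) (interior (domain μ ε L I))
  maxwell_E : ∀ x t : ℝ, (x, t) ∈ interior (domain μ ε L I) →
    (ε x : ℂ) * deriv (fun s => E x s) t = Complex.I * deriv (fun y => H y t) x
  maxwell_H : ∀ x t : ℝ, (x, t) ∈ interior (domain μ ε L I) →
    Complex.I * deriv (fun y => E y t) x = -(μ : ℂ) * deriv (fun s => H x s) t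
  initial_E : ∀ t ∈ I, E 0 t = E₀ t
  initial_H : ∀ t ∈ I, H 0 t = H₀ t

/-- The frequency `ω₀ + m ω`. -/
def freq (ω₀ ω : ℂ) (m : ℤ) : ℂ := ω₀ + m * ω

/-- The modulated signal `∑_{m = -M}^{M} α_m e^{i (ω₀ + m ω) t}`. -/
def modulated (M : ℕ) (ω₀ ω : ℂ) (α : ℤ → ℂ) (t : ℝ) : ℂ :=
  ∑ m ∈ Finset.Icc (-(M : ℤ)) M, α m * Complex.exp (Complex.I * freq ω₀ ω m * t)

/-- `c_m⁺ = √c(0) (√ε(0) α_m + i √μ β_m)`, the sum of the two complex components of the bicomplex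
number `c_m = √c(0) (√ε(0) α_m + i j √μ β_m)`. -/
def cPlus (μ : ℝ) (ε : ℝ → ℝ) (α β : ℤ → ℂ) (m : ℤ) : ℂ :=
  (√(speed μ ε 0) : ℂ) * ((√(ε 0) : ℂ) * α m + Complex.I * (√μ : ℂ) * β m)

/-- `c_m⁻ = √c(0) (√ε(0) α_m - i √μ β_m)`, the difference of the two complex components of
`c_m`. -/
def cMinus (μ : ℝ) (ε : ℝ → ℝ) (α β : ℤ → ℂ) (m : ℤ) : ℂ :=
  (√(speed μ ε 0) : ℂ) * ((√(ε 0) : ℂ) * α m - Complex.I * (√μ : ℂ) * β m)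

/-- The `n`-th term `d_n(ξ) e^{nπi/2} j_n(λ ξ)` of a Neumann series with coefficients `d_n`. -/
def neumannTerm (d : ℕ → ℝ → ℝ) (lam : ℂ) (ξ : ℝ) (n : ℕ) : ℂ :=
  (d n ξ : ℂ) * Complex.exp (n * Real.pi * Complex.I / 2) * sphericalBesselJ n (lam * ξ)

end MaxwellNSBF

end

/-! In the variable ξ a wave of frequency λ separates. With F² = c(0)/c, the problem reduces to Y' =
iλ F⁻² Z, Z' = iλ F² Y with Y(0) = Z(0) = 1. Its solution is a power series in λ whose coefficients
are the iterated integrals with alternating weights F⁻², F². These series converge for every λ and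
can be differentiated termwise (`hasDerivAt_spectralSeries`). Finite superpositions of the solutions
for λ and -λ therefore solve the Maxwell system and match the modulated data (`isSolution_modeSum`).

The Neumann series come from the classical expansion e^{izx} = Σ (2n+1) iⁿ j_n(z) P_n(x). Apply to
it the linear functional that sends x^k to φ_k(ξ)/ξ^k, with z = λξ. The left side becomes Σ (iλ)^k
φ_k(ξ)/k! = F(ξ) Y(ξ), and the right side contains Σ_k l_{k,n} φ_k(ξ)/ξ^k. Subtracting the same
expansion at x = 1, where every P_n equals 1, produces e^{iλξ} and the -1 in a_n. The functional
acts on polynomials only, so the argument is carried out on coefficients: the expansion of x^k/k! in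
Legendre polynomials is finite, the functional grows at most geometrically on P_n
(`norm_momentFunctional_legendre_le`), and the expansion coefficients decay factorially. This makes
the double series absolutely summable, and `hasSum_neumann` exchanges the order of summation. The
same holds for ψ_k, Z and b_n.

Uniqueness (`IsSolution.eq_zero`) uses the Riemann invariants √ε E ± i√μ H. Along its characteristic
the derivative of each is (√ε)' E, which the two invariants bound. With zero data, integration along
characteristics is a contraction in a norm with exponential weight, so both invariants vanish. -/

noncomputable section
-- Legendre polynomials, moment functionals and Neumann series of spherical Bessel functions
namespace MaxwellLegendre

open Polynomial
open MaxwellNSBF hiding X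

/-- The `n`-th derivative of `(X² - 1) ^ (n + 1)`, normalized so that its derivative is
`legendre (n + 1)`. -/
def legendrePrimitive (n : ℕ) : ℝ[X] :=
  C ((2 ^ (n + 1) * ((n + 1).factorial : ℝ))⁻¹) * derivative^[n] ((X ^ 2 - 1) ^ (n + 1))

/-- With u = x² - 1, one derivative of u^(n+2) gives 2(n+2) x u^(n+1), and the Leibniz rule for the
factor x leaves two terms. Eliminating the primitive between this identity and
`legendre_succ_eq_add` gives the three-term recurrence. -/
theorem legendre_succ_eq_X_mul_add (n : ℕ) :
    legendre (n + 2) = X * legendre (n + 1) + C ((n : ℝ) + 1) * legendrePrimitive n := by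
  have h1 : derivative^[n + 2] ((X ^ 2 - 1 : ℝ[X]) ^ (n + 2)) =
      C (2 * ((n : ℝ) + 2)) * (X * derivative^[n + 1] ((X ^ 2 - 1 : ℝ[X]) ^ (n + 1)) +
        C ((n : ℝ) + 1) * derivative^[n] ((X ^ 2 - 1 : ℝ[X]) ^ (n + 1))) := by
    have h2 : derivative ((X ^ 2 - 1 : ℝ[X]) ^ (n + 2)) =
        C (2 * ((n : ℝ) + 2)) * ((X ^ 2 - 1 : ℝ[X]) ^ (n + 1) * X) := by
      rw [derivative_pow]
      simp only [derivative_sub, derivative_X_pow, derivative_one, map_mul, map_add, map_natCast,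
        Nat.cast_add, Nat.cast_ofNat]
      simp only [map_ofNat]
      simp
      ring
    rw [show n + 2 = (n + 1) + 1 from rfl, Function.iterate_succ_apply, h2,
      iterate_derivative_C_mul, iterate_derivative_mul_X]
    simp only [Nat.add_sub_cancel, nsmul_eq_mul]
    push_cast
    simp only [map_add, map_natCast, map_one]
    ring
  have h3 : (2 ^ (n + 2) * ((n + 2).factorial : ℝ))⁻¹ * (2 * ((n : ℝ) + 2)) =
      (2 ^ (n + 1) * ((n + 1).factorial : ℝ))⁻¹ := by
    have : ((n + 1).factorial : ℝ) ≠ 0 := by positivity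
    have : (n : ℝ) + 2 ≠ 0 := by positivity
    rw [Nat.factorial_succ (n + 1)]
    push_cast
    field_simp
    ring
  rw [legendre, legendre, legendrePrimitive, h1, ← mul_assoc, ← C_mul, h3]
  ring

/-- Here two derivatives of u^(n+2) are taken first, and x² = u + 1 removes the explicit x. -/
theorem legendre_succ_eq_add (n : ℕ) :
    legendre (n + 2) = C (2 * (n : ℝ) + 3) * legendrePrimitive n + legendre n := by
  have h1 : derivative (derivative ((X ^ 2 - 1 : ℝ[X]) ^ (n + 2))) =
      C (2 * ((n : ℝ) + 2)) * (C (2 * (n : ℝ) + 3) * (X ^ 2 - 1 : ℝ[X]) ^ (n + 1) +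
        C (2 * ((n : ℝ) + 1)) * (X ^ 2 - 1 : ℝ[X]) ^ n) := by
    simp only [derivative_pow, derivative_mul, derivative_sub, derivative_one, map_mul, map_add, map_natCast, map_ofNat, map_one]
    simp
    ring
  have h2 : derivative^[n + 2] ((X ^ 2 - 1 : ℝ[X]) ^ (n + 2)) =
      C (2 * ((n : ℝ) + 2)) * (C (2 * (n : ℝ) + 3) * derivative^[n] ((X ^ 2 - 1 : ℝ[X]) ^ (n + 1)) +
        C (2 * ((n : ℝ) + 1)) * derivative^[n] ((X ^ 2 - 1 : ℝ[X]) ^ n)) := by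
    rw [Function.iterate_add_apply]
    simp only [Function.iterate_succ_apply, Function.iterate_zero_apply]
    rw [h1, iterate_derivative_C_mul, iterate_map_add, iterate_derivative_C_mul,
      iterate_derivative_C_mul]
  have h3 : (2 ^ (n + 2) * ((n + 2).factorial : ℝ))⁻¹ * (2 * ((n : ℝ) + 2)) =
      (2 ^ (n + 1) * ((n + 1).factorial : ℝ))⁻¹ := by
    have : ((n + 1).factorial : ℝ) ≠ 0 := by positivity
    have : (n : ℝ) + 2 ≠ 0 := by positivity
    rw [Nat.factorial_succ (n + 1)]
    push_cast
    field_simp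
    ring
  have h4 : (2 ^ (n + 1) * ((n + 1).factorial : ℝ))⁻¹ * (2 * ((n : ℝ) + 1)) =
      (2 ^ n * (n.factorial : ℝ))⁻¹ := by
    have : (n.factorial : ℝ) ≠ 0 := by positivity
    have : (n : ℝ) + 1 ≠ 0 := by positivity
    rw [Nat.factorial_succ n]
    push_cast
    field_simp
    ring
  rw [legendre, legendre, legendrePrimitive, h2, ← mul_assoc, ← C_mul, h3, ← h4,
    C_mul (a := (2 ^ (n + 1) * ((n + 1).factorial : ℝ))⁻¹) (b := 2 * ((n : ℝ) + 1))]
  simp only [mul_add, mul_assoc, mul_left_comm]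

theorem legendre_zero : legendre 0 = 1 := by simp [legendre]

theorem legendre_one : legendre 1 = X := by
  simp only [legendre, Nat.factorial, Function.iterate_one, pow_one, derivative_sub,
    derivative_X_pow, derivative_one]
  rw [sub_zero, ← mul_assoc]
  norm_num [← C_mul]

/-- Bonnet's recurrence. -/
theorem legendre_recurrence (n : ℕ) :
    C ((n : ℝ) + 2) * legendre (n + 2) + C ((n : ℝ) + 1) * legendre n =
      C (2 * (n : ℝ) + 3) * (X * legendre (n + 1)) := by
  have h1 := legendre_succ_eq_X_mul_add n
  have h2 := legendre_succ_eq_add n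
  simp only [map_add, map_mul, map_natCast, map_ofNat, map_one] at *
  linear_combination (2 * (n : ℝ[X]) + 3) * h1 - ((n : ℝ[X]) + 1) * h2

theorem legendre_eval_one (n : ℕ) : (legendre n).eval 1 = 1 := by
  induction n using Nat.twoStepInduction with
  | zero => simp [legendre_zero]
  | one => simp [legendre_one]
  | more n h0 h1 =>
    have h := congrArg (eval 1) (legendre_recurrence n)
    simp only [eval_add, eval_mul, eval_C, eval_X, h0, h1] at h
    have : (n : ℝ) + 2 ≠ 0 := by positivity
    apply mul_left_cancel₀ this
    linear_combination h

theorem legendre_natDegree_le (n : ℕ) : (legendre n).natDegree ≤ n := by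
  have h : ((X ^ 2 - 1 : ℝ[X]) ^ n).natDegree ≤ n * 2 :=
    natDegree_pow_le_of_le n (by compute_degree)
  refine (natDegree_C_mul_le _ _).trans ((natDegree_iterate_derivative _ n).trans ?_)
  omega

/-- The linear functional on polynomials that sends `X ^ k` to `m k`. -/
def momentFunctional (m : ℕ → ℂ) : ℝ[X] →ₗ[ℝ] ℂ :=
  Polynomial.lsum fun k => LinearMap.toSpanSingleton ℝ ℂ (m k)

theorem momentFunctional_apply (m : ℕ → ℂ) {p : ℝ[X]} {n : ℕ} (hp : p.natDegree ≤ n) :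
    momentFunctional m p = ∑ k ∈ Finset.range (n + 1), (p.coeff k : ℂ) * m k := by
  rw [momentFunctional, Polynomial.lsum_apply,
    Polynomial.sum_over_range' _ (by simp) (n + 1) (by omega)]
  simp

theorem momentFunctional_X_pow (m : ℕ → ℂ) (k : ℕ) : momentFunctional m (X ^ k) = m k := by
  rw [momentFunctional_apply m (natDegree_X_pow_le k), Finset.sum_eq_single k]
  · simp
  · intro b _ hb; simp [coeff_X_pow, hb]
  · simp

theorem momentFunctional_X_mul (m : ℕ → ℂ) (p : ℝ[X]) :
    momentFunctional m (X * p) = momentFunctional (fun k => m (k + 1)) p := by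
  induction p using Polynomial.induction_on' with
  | add p q hp hq => simp [mul_add, hp, hq]
  | monomial n a =>
    rw [X_mul_monomial]
    simp [momentFunctional]

/-- Under the functional, multiplication by `X` becomes a shift of the moments. This is why the
inductions that use the recurrence must vary `m`. -/
theorem momentFunctional_legendre_recurrence (m : ℕ → ℂ) (n : ℕ) :
    ((n : ℂ) + 2) * momentFunctional m (legendre (n + 2)) +
        ((n : ℂ) + 1) * momentFunctional m (legendre n) =
      (2 * (n : ℂ) + 3) * momentFunctional (fun k => m (k + 1)) (legendre (n + 1)) := by
  have h := congrArg (momentFunctional m) (legendre_recurrence n)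
  rw [C_mul', C_mul', C_mul', map_add, map_smul, map_smul, map_smul, momentFunctional_X_mul] at h
  simpa only [Complex.real_smul, Complex.ofReal_add, Complex.ofReal_mul, Complex.ofReal_natCast,
    Complex.ofReal_ofNat, Complex.ofReal_one] using h

/-- Induction along Bonnet's recurrence: a shift of the moments replaces `K` by `K * R` and keeps
the rate `R`. -/
theorem norm_momentFunctional_legendre_le {K R : ℝ} (hR : 0 ≤ R) {m : ℕ → ℂ}
    (hm : ∀ k, ‖m k‖ ≤ K * R ^ k) (n : ℕ) :
    ‖momentFunctional m (legendre n)‖ ≤ K * (2 * R + 1) ^ n := by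
  have hK : 0 ≤ K := by simpa using (norm_nonneg _).trans (hm 0)
  induction n using Nat.twoStepInduction generalizing m K with
  | zero =>
    rw [legendre_zero, ← pow_zero (X : ℝ[X]), momentFunctional_X_pow]
    simpa using hm 0
  | one =>
    rw [legendre_one, ← pow_one (X : ℝ[X]), momentFunctional_X_pow]
    refine (hm 1).trans ?_
    gcongr
    linarith
  | more n h0 h1 =>
    have h := momentFunctional_legendre_recurrence m n
    have h0' := h0 hm hK
    have h1' := h1 (K := K * R) (m := fun k => m (k + 1))
      (fun k => (hm (k + 1)).trans (by rw [pow_succ']; linarith)) (by positivity)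
    have hn : (0 : ℝ) ≤ n := n.cast_nonneg
    have e1 : ((n : ℝ) + 2) * ‖momentFunctional m (legendre (n + 2))‖ ≤
        (2 * n + 3) * (K * R * (2 * R + 1) ^ (n + 1)) + (n + 1) * (K * (2 * R + 1) ^ n) := by
      calc ((n : ℝ) + 2) * ‖momentFunctional m (legendre (n + 2))‖
          = ‖((n : ℂ) + 2) * momentFunctional m (legendre (n + 2))‖ := by
            rw [norm_mul]; congr 1; symm; exact_mod_cast Complex.norm_natCast (n + 2)
        _ = ‖(2 * (n : ℂ) + 3) * momentFunctional (fun k => m (k + 1)) (legendre (n + 1)) -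
              ((n : ℂ) + 1) * momentFunctional m (legendre n)‖ := by rw [← h]; congr 1; ring
        _ ≤ _ := by
            refine (norm_sub_le _ _).trans ?_
            rw [norm_mul, norm_mul]
            have a1 : ‖(2 * (n : ℂ) + 3)‖ = 2 * n + 3 := by
              exact_mod_cast Complex.norm_natCast (2 * n + 3)
            have a2 : ‖((n : ℂ) + 1)‖ = n + 1 := by exact_mod_cast Complex.norm_natCast (n + 1)
            rw [a1, a2]
            gcongr
    refine le_of_mul_le_mul_left (e1.trans ?_) (by positivity : (0 : ℝ) < n + 2)
    have e2 : 0 ≤ K * (2 * R + 1) ^ n := by positivity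
    -- With ρ = 2R + 1 the expression is (n+2)ρ + Rρ - (n+1), and ρ ≥ 1. This is what the rate 2R +
    -- 1 is chosen for.
    have e3 : 0 ≤ (n + 2 : ℝ) * (2 * R + 1) ^ 2 - (2 * n + 3) * (R * (2 * R + 1)) - (n + 1) := by
      nlinarith [mul_nonneg hn hR, mul_nonneg hn (mul_nonneg hR hR), mul_nonneg hR hR]
    have := mul_nonneg e2 e3
    rw [pow_succ, pow_add]
    linarith

/-- The coefficient of `P_n` in the Legendre expansion of `X ^ k / k!`, divided by `2n + 1`. -/
def monomialCoeff (n k : ℕ) : ℝ :=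
  if n ≤ k ∧ Even (k - n) then
    ((2 : ℝ) ^ ((k - n) / 2) * ((k - n) / 2).factorial * ((n + k + 1).doubleFactorial : ℝ))⁻¹
  else 0

theorem monomialCoeff_add_two_mul (n p : ℕ) : monomialCoeff n (n + 2 * p) =
    ((2 : ℝ) ^ p * p.factorial * ((2 * n + 2 * p + 1).doubleFactorial : ℝ))⁻¹ := by
  have h1 : (n + 2 * p - n) = 2 * p := by omega
  have h2 : n + (n + 2 * p) + 1 = 2 * n + 2 * p + 1 := by ring
  rw [monomialCoeff, if_pos ⟨by omega, by simp [h1]⟩, h1, h2]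
  simp

theorem monomialCoeff_eq_zero {n k : ℕ} (h : ∀ p, k ≠ n + 2 * p) : monomialCoeff n k = 0 := by
  rw [monomialCoeff, if_neg]
  rintro ⟨h1, p, hp⟩
  exact h p (by omega)

/-- This is the coefficient of P_0 in the comparison described at `monomialCoeff_succ_recurrence`.
-/
theorem monomialCoeff_zero_recurrence (k : ℕ) :
    ((k : ℝ) + 1) * monomialCoeff 0 (k + 1) = monomialCoeff 1 k := by
  by_cases h : ∃ p, k = 1 + 2 * p
  · obtain ⟨p, rfl⟩ := h
    rw [show 1 + 2 * p + 1 = 0 + 2 * (p + 1) by ring, monomialCoeff_add_two_mul,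
      monomialCoeff_add_two_mul, show 2 * 0 + 2 * (p + 1) + 1 = 2 * 1 + 2 * p + 1 by ring,
      Nat.factorial_succ]
    have : ((2 * 1 + 2 * p + 1).doubleFactorial : ℝ) ≠ 0 := by
      exact_mod_cast (Nat.doubleFactorial_pos _).ne'
    have : (p.factorial : ℝ) ≠ 0 := by positivity
    push_cast
    field_simp
    ring
  · push Not at h
    rw [monomialCoeff_eq_zero h, monomialCoeff_eq_zero, mul_zero]
    intro p hp
    rcases p with _ | p
    · omega
    · exact h p (by omega)

/-- Multiplying the expansion of x^k/k! by x, expanding each x P_j by Bonnet's recurrence and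
comparing coefficients of P_{n+1} predicts this relation. Since the coefficients are given in closed
form, it is verified directly and then drives the induction that proves the expansion. -/
theorem monomialCoeff_succ_recurrence (n k : ℕ) :
    ((k : ℝ) + 1) * (2 * n + 3) * monomialCoeff (n + 1) (k + 1) =
      (n + 1) * monomialCoeff n k + (n + 2) * monomialCoeff (n + 2) k := by
  by_cases h : ∃ p, k = n + 2 * p
  · obtain ⟨p, rfl⟩ := h
    rw [show n + 2 * p + 1 = (n + 1) + 2 * p by ring, monomialCoeff_add_two_mul,
      monomialCoeff_add_two_mul]
    -- For k = n the coefficient with index n + 2 vanishes; otherwise k = (n + 2) + 2p with the new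
    -- p.
    rcases p with _ | p
    · rw [monomialCoeff_eq_zero (n := n + 2) (by intro p; omega),
        show 2 * (n + 1) + 2 * 0 + 1 = (2 * n + 2 * 0 + 1) + 2 by ring,
        Nat.doubleFactorial_add_two]
      have : ((2 * n + 2 * 0 + 1).doubleFactorial : ℝ) ≠ 0 := by
        exact_mod_cast (Nat.doubleFactorial_pos _).ne'
      push_cast
      simp only [Nat.factorial]
      have : (2 * (n : ℝ) + 2 * 0 + 1 + 2) ≠ 0 := by positivity
      field_simp
      simp
      ring
    · rw [show n + 2 * (p + 1) = n + 2 + 2 * p by ring, monomialCoeff_add_two_mul,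
        show 2 * (n + 1) + 2 * (p + 1) + 1 = (2 * n + 2 * p + 3) + 2 by ring,
        show 2 * (n + 2) + 2 * p + 1 = (2 * n + 2 * p + 3) + 2 by ring,
        show 2 * n + 2 * (p + 1) + 1 = 2 * n + 2 * p + 3 by ring,
        Nat.doubleFactorial_add_two, Nat.factorial_succ]
      have : ((2 * n + 2 * p + 3).doubleFactorial : ℝ) ≠ 0 := by
        exact_mod_cast (Nat.doubleFactorial_pos _).ne'
      have : (p.factorial : ℝ) ≠ 0 := by positivity
      push_cast
      field_simp
      ring
  · push Not at h
    rw [monomialCoeff_eq_zero h, monomialCoeff_eq_zero (n := n + 2),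
      monomialCoeff_eq_zero (n := n + 1)]
    · ring
    · intro p hp; exact h p (by omega)
    · intro p hp; exact h (p + 1) (by omega)

/-- The Legendre expansion of the monomials, under a linear functional. -/
theorem sum_momentFunctional_legendre (m : ℕ → ℂ) (k N : ℕ) (hN : k < N) :
    ∑ n ∈ Finset.range N,
      (2 * (n : ℂ) + 1) * (monomialCoeff n k : ℂ) * momentFunctional m (legendre n) =
      m k / (k.factorial : ℂ) := by
  have hz : ∀ n k : ℕ, k < n → monomialCoeff n k = 0 := fun n k h =>
    monomialCoeff_eq_zero (by intro p; omega)
  induction k generalizing m N with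
  | zero =>
    rw [Finset.sum_eq_single 0]
    · have := monomialCoeff_add_two_mul 0 0
      norm_num at this
      rw [this, legendre_zero, ← pow_zero (X : ℝ[X]), momentFunctional_X_pow]
      simp
    · intro n _ hn
      rw [hz n 0 (by omega)]; simp
    · simp; omega
  | succ k ih =>
    obtain ⟨N, rfl⟩ : ∃ N', N = N' + 2 := ⟨N - 2, by omega⟩
    -- X^(k+1) = X · X^k, so the induction hypothesis is used for the shifted moments.
    have h0 := ih (fun j => m (j + 1)) (N + 1) (by omega)
    have key : ((k : ℂ) + 1) * ∑ n ∈ Finset.range (N + 2),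
        (2 * (n : ℂ) + 1) * (monomialCoeff n (k + 1) : ℂ) * momentFunctional m (legendre n) =
        m (k + 1) / (k.factorial : ℂ) := by
      have e1 : ∀ n : ℕ, ((k : ℂ) + 1) * ((2 * ((n + 1 : ℕ) : ℂ) + 1) *
          (monomialCoeff (n + 1) (k + 1) : ℂ) * momentFunctional m (legendre (n + 1))) =
          ((n : ℂ) + 1) * monomialCoeff n k * momentFunctional m (legendre (n + 1)) +
          (((n + 1 : ℕ) : ℂ) + 1) * monomialCoeff (n + 1 + 1) k *
            momentFunctional m (legendre (n + 1)) := by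
        intro n
        have h := congrArg (fun x : ℝ => (x : ℂ)) (monomialCoeff_succ_recurrence n k)
        push_cast at h ⊢
        linear_combination momentFunctional m (legendre (n + 1)) * h
      have e2 : ∀ n : ℕ, (2 * ((n + 1 : ℕ) : ℂ) + 1) * (monomialCoeff (n + 1) k : ℂ) *
          momentFunctional (fun j => m (j + 1)) (legendre (n + 1)) =
          (((n + 1 : ℕ) : ℂ) + 1) * monomialCoeff (n + 1) k *
            momentFunctional m (legendre (n + 1 + 1)) +
          ((n : ℂ) + 1) * monomialCoeff (n + 1) k * momentFunctional m (legendre n) := by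
        intro n
        have h := momentFunctional_legendre_recurrence m n
        push_cast
        linear_combination -(monomialCoeff (n + 1) k : ℂ) * h
      have e3 : momentFunctional (fun j => m (j + 1)) (legendre 0) =
          momentFunctional m (legendre 1) := by
        rw [legendre_zero, legendre_one, ← momentFunctional_X_mul, mul_one]
      have e4 := congrArg (fun x : ℝ => (x : ℂ)) (monomialCoeff_zero_recurrence k)
      push_cast at e4
      rw [← h0, Finset.sum_range_succ' _ (N + 1), mul_add, Finset.mul_sum,
        Finset.sum_congr rfl fun n _ => e1 n, Finset.sum_add_distrib,
        Finset.sum_range_succ' (fun n : ℕ => (2 * (n : ℂ) + 1) * (monomialCoeff n k : ℂ) *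
          momentFunctional (fun j => m (j + 1)) (legendre n)) N,
        Finset.sum_congr rfl fun n _ => e2 n, e3, Finset.sum_add_distrib]
      -- The sums differ by shifts of the index. The two top terms drop out because k < N + 1, and
      -- the bottom terms are matched by `e4`.
      have f1 := Finset.sum_range_succ' (fun n : ℕ => ((n : ℂ) + 1) * monomialCoeff (n + 1) k *
        momentFunctional m (legendre n)) (N + 1)
      rw [Finset.sum_range_succ, Finset.sum_range_succ, hz (N + 1) k (by omega),
        hz (N + 1 + 1) k (by omega)] at f1
      have f2 := Finset.sum_range_succ' (fun n : ℕ => ((n : ℂ) + 1) * monomialCoeff n k *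
        momentFunctional m (legendre (n + 1))) N
      simp only [Complex.ofReal_zero, mul_zero, zero_mul, add_zero, Nat.cast_zero, zero_add,
        one_mul] at f1 f2 ⊢
      linear_combination f2 - f1 + momentFunctional m (legendre 0) * e4
    have : (k : ℂ) + 1 ≠ 0 := by exact_mod_cast Nat.succ_ne_zero k
    rw [Nat.factorial_succ]
    push_cast
    rw [mul_comm (k + 1 : ℂ), ← div_div, ← key]
    field_simp

theorem factorial_le_doubleFactorial (n p : ℕ) :
    n.factorial ≤ (2 * n + 2 * p + 1).doubleFactorial := by
  induction n with
  | zero => exact Nat.doubleFactorial_pos _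
  | succ n ih =>
    rw [show 2 * (n + 1) + 2 * p + 1 = (2 * n + 2 * p + 1) + 2 by ring,
      Nat.doubleFactorial_add_two, Nat.factorial_succ]
    exact Nat.mul_le_mul (by omega) ih

/-- The bound separates n from p, so the double series is dominated by a product of two series of
exponential type. The factorial in n also absorbs the geometric growth of the functional on P_n. -/
theorem norm_monomialCoeff_mul_pow_le (z : ℂ) (n p : ℕ) :
    ‖(monomialCoeff n (n + 2 * p) : ℂ) * (Complex.I * z) ^ (n + 2 * p)‖ ≤
      ‖z‖ ^ n / n.factorial * ((‖z‖ ^ 2) ^ p / p.factorial) := by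
  rw [norm_mul, norm_pow, norm_mul, Complex.norm_I, one_mul, pow_add, pow_mul,
    monomialCoeff_add_two_mul, Complex.norm_real, Real.norm_of_nonneg (by positivity)]
  have h1 : (n.factorial : ℝ) ≤ ((2 * n + 2 * p + 1).doubleFactorial : ℝ) :=
    mod_cast factorial_le_doubleFactorial n p
  have h2 : (1 : ℝ) ≤ 2 ^ p := one_le_pow₀ (by norm_num)
  have h3 : ((2 : ℝ) ^ p * p.factorial * ((2 * n + 2 * p + 1).doubleFactorial : ℝ))⁻¹ ≤
      (1 * p.factorial * (n.factorial : ℝ))⁻¹ := by gcongr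
  calc _ ≤ (1 * p.factorial * (n.factorial : ℝ))⁻¹ * (‖z‖ ^ n * (‖z‖ ^ 2) ^ p) := by gcongr
    _ = _ := by field_simp

theorem injective_add_two_mul (n : ℕ) : Function.Injective fun p : ℕ => n + 2 * p := by
  intro a b h
  simpa using h

/-- Only k = n + 2p contributes, and (iz)^(n+2p) = iⁿ zⁿ (-z²)^p turns the sum into the defining
series of j_n. -/
theorem hasSum_monomialCoeff_mul_pow (z : ℂ) (n : ℕ) :
    HasSum (fun k => (monomialCoeff n k : ℂ) * (Complex.I * z) ^ k)
      (Complex.I ^ n * sphericalBesselJ n z) := by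
  rw [← (injective_add_two_mul n).hasSum_iff]
  · have hs : Summable fun p : ℕ =>
        (monomialCoeff n (n + 2 * p) : ℂ) * (Complex.I * z) ^ (n + 2 * p) :=
      .of_norm_bounded ((Real.summable_pow_div_factorial (‖z‖ ^ 2)).mul_left _)
        (norm_monomialCoeff_mul_pow_le z n)
    suffices h : Complex.I ^ n * sphericalBesselJ n z = ∑' p : ℕ,
        (monomialCoeff n (n + 2 * p) : ℂ) * (Complex.I * z) ^ (n + 2 * p) by
      rw [h]
      exact hs.hasSum
    rw [sphericalBesselJ, ← mul_assoc, ← tsum_mul_left]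
    congr 1
    ext p
    rw [monomialCoeff_add_two_mul, mul_pow, pow_add Complex.I, pow_mul, Complex.I_sq, neg_div',
      div_pow, neg_pow (z ^ 2), pow_add z, pow_mul z]
    push_cast
    field_simp
  · intro k hk
    rw [monomialCoeff_eq_zero]
    · simp
    · intro p hp
      exact hk ⟨p, hp.symm⟩

/-- The Neumann series of spherical Bessel functions attached to a moment sequence of at most
exponential growth. -/
theorem hasSum_neumann {K R : ℝ} (hR : 0 ≤ R) {m : ℕ → ℂ} (hm : ∀ k, ‖m k‖ ≤ K * R ^ k) (z : ℂ) :
    HasSum (fun n : ℕ => (2 * (n : ℂ) + 1) * momentFunctional m (legendre n) *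
        (Complex.I ^ n * sphericalBesselJ n z))
      (∑' k : ℕ, (Complex.I * z) ^ k / (k.factorial : ℂ) * m k) := by
  have hK : 0 ≤ K := by simpa using (norm_nonneg _).trans (hm 0)
  set T : ℕ × ℕ → ℂ := fun q => (2 * (q.1 : ℂ) + 1) * momentFunctional m (legendre q.1) *
    ((monomialCoeff q.1 q.2 : ℂ) * (Complex.I * z) ^ q.2) with hT
  have hinj : Function.Injective fun q : ℕ × ℕ => (q.1, q.1 + 2 * q.2) := by
    rintro ⟨a, b⟩ ⟨c, d⟩ h
    simp only [Prod.mk.injEq] at h ⊢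
    omega
  have hsum : Summable T := by
    -- `T` vanishes off the pairs (n, n + 2p), so summability is tested in the coordinates (n, p).
    rw [← hinj.summable_iff]
    · have hA : Summable fun n : ℕ => K * (2 * ((2 * R + 1) * ‖z‖ * 2) ^ n / n.factorial) := by
        simpa only [mul_div_assoc] using
          ((Real.summable_pow_div_factorial ((2 * R + 1) * ‖z‖ * 2)).mul_left 2).mul_left K
      have hB := Real.summable_pow_div_factorial (‖z‖ ^ 2)
      refine .of_norm_bounded (hA.mul_of_nonneg hB (fun n => by positivity)
        (fun n => by positivity)) ?_
      rintro ⟨n, p⟩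
      simp only [hT, Function.comp_apply, norm_mul (_ * _ : ℂ) ((_ : ℂ) * _ ^ _)]
      have h1 : ‖(2 * (n : ℂ) + 1)‖ ≤ 2 * 2 ^ n := by
        have a1 : ‖(2 * (n : ℂ) + 1)‖ = 2 * n + 1 := by
          exact_mod_cast Complex.norm_natCast (2 * n + 1)
        rw [a1]
        have : (n + 1 : ℕ) ≤ 2 ^ n := Nat.lt_two_pow_self
        have : (n + 1 : ℝ) ≤ 2 ^ n := mod_cast this
        linarith
      calc _ ≤ (2 * 2 ^ n) * (K * (2 * R + 1) ^ n) *
            (‖z‖ ^ n / n.factorial * ((‖z‖ ^ 2) ^ p / p.factorial)) := by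
            rw [norm_mul]
            gcongr
            · exact norm_momentFunctional_legendre_le hR hm n
            · exact norm_monomialCoeff_mul_pow_le z n p
        _ = _ := by rw [mul_pow, mul_pow]; ring
    · rintro ⟨n, k⟩ h
      simp only [hT]
      rw [monomialCoeff_eq_zero]
      · simp
      · intro p hp
        exact h ⟨(n, p), by simp [hp]⟩
  -- Summing over k first gives the Bessel functions; summing over n first gives, by the finite
  -- Legendre expansion of X^k/k!, the moment m_k.
  have h1 := hsum.hasSum.prod_fiberwise fun n =>
    (hasSum_monomialCoeff_mul_pow z n).mul_left
      ((2 * (n : ℂ) + 1) * momentFunctional m (legendre n))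
  have h2 := ((Equiv.prodComm ℕ ℕ).hasSum_iff.mpr hsum.hasSum).prod_fiberwise
    (g := fun k : ℕ => (Complex.I * z) ^ k / (k.factorial : ℂ) * m k) fun k => by
      have h3 := hasSum_sum_of_ne_finset_zero (L := .unconditional ℕ)
        (f := fun n => T (n, k)) (s := Finset.range (k + 1)) (by
          intro n hn
          simp only [Finset.mem_range, not_lt] at hn
          simp only [hT]
          rw [monomialCoeff_eq_zero (by intro p; omega)]
          simp)
      change HasSum (fun n => T (n, k)) _
      convert h3 using 1
      rw [div_mul_eq_mul_div, mul_div_assoc,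
        ← sum_momentFunctional_legendre m k (k + 1) (by omega), Finset.mul_sum]
      refine Finset.sum_congr rfl fun n _ => ?_
      simp only [hT]
      ring
  rw [h2.tsum_eq]
  exact h1

/-- With all moments equal to 1 the functional is evaluation at 1, where every P_n has the value 1.
-/
theorem hasSum_neumann_exp (z : ℂ) :
    HasSum (fun n : ℕ => (2 * (n : ℂ) + 1) * (Complex.I ^ n * sphericalBesselJ n z))
      (Complex.exp (Complex.I * z)) := by
  have h := hasSum_neumann (K := 1) (R := 1) zero_le_one (m := fun _ => 1) (by simp) z
  have h1 : ∀ n, momentFunctional (fun _ => 1) (legendre n) = 1 := by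
    intro n
    have := legendre_eval_one n
    rw [eval_eq_sum_range' (Nat.lt_succ_of_le (legendre_natDegree_le n))] at this
    rw [momentFunctional_apply _ (legendre_natDegree_le n)]
    simp only [one_pow, mul_one] at this ⊢
    exact_mod_cast this
  simp only [h1, mul_one] at h
  rwa [Complex.exp_eq_exp_ℂ, NormedSpace.exp_eq_tsum_div]

theorem sphericalBesselJ_neg (n : ℕ) (z : ℂ) :
    sphericalBesselJ n (-z) = (-1) ^ n * sphericalBesselJ n z := by
  rw [sphericalBesselJ, sphericalBesselJ, neg_pow z n, neg_sq, mul_assoc]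

end MaxwellLegendre

end

/-! ### Iterated integrals and power series in the spectral parameter -/

noncomputable section
namespace MaxwellNSBF

/-- Iterated integrals with the weights `r, s, r, s, …` (the outermost one being `r`). -/
def iterInt : (ℝ → ℝ) → (ℝ → ℝ) → ℕ → ℝ → ℝ
  | _, _, 0 => fun _ => 1
  | r, s, n + 1 => fun x => ((n : ℝ) + 1) * ∫ y in (0 : ℝ)..x, iterInt s r n y * r y

theorem iterInt_zero (r s : ℝ → ℝ) (x : ℝ) : iterInt r s 0 x = 1 := by rw [iterInt]

theorem iterInt_succ (r s : ℝ → ℝ) (n : ℕ) (x : ℝ) :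
    iterInt r s (n + 1) x = ((n : ℝ) + 1) * ∫ y in (0 : ℝ)..x, iterInt s r n y * r y := by
  rw [iterInt]

theorem iterInt_succ_at_zero (r s : ℝ → ℝ) (n : ℕ) : iterInt r s (n + 1) 0 = 0 := by
  simp [iterInt_succ]

theorem continuous_iterInt {r s : ℝ → ℝ} (hr : Continuous r) (hs : Continuous s) (n : ℕ) :
    Continuous (iterInt r s n) := by
  induction n generalizing r s with
  | zero => rw [iterInt]; exact continuous_const
  | succ n ih =>
    rw [iterInt]
    exact continuous_const.mul (intervalIntegral.continuous_primitive
      (fun a b => ((ih hs hr).mul hr).intervalIntegrable a b) 0)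

theorem hasDerivAt_iterInt_succ {r s : ℝ → ℝ} (hr : Continuous r) (hs : Continuous s) (n : ℕ)
    (x : ℝ) : HasDerivAt (iterInt r s (n + 1)) (((n : ℝ) + 1) * (iterInt s r n x * r x)) x := by
  rw [iterInt]
  have hc : Continuous fun y => iterInt s r n y * r y := (continuous_iterInt hs hr n).mul hr
  exact (intervalIntegral.integral_hasDerivAt_right (hc.intervalIntegrable 0 x)
    (hc.stronglyMeasurableAtFilter _ _) hc.continuousAt).const_mul _

/-- The factor n + 1 in the recursion cancels the one from integrating |y|^n. The growth is thus
purely geometric, as `hasSum_neumann` requires of moments. -/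
theorem abs_iterInt_le {r s : ℝ → ℝ} {C : ℝ} (hr : ∀ x, |r x| ≤ C) (hs : ∀ x, |s x| ≤ C)
    (n : ℕ) (x : ℝ) : |iterInt r s n x| ≤ (C * |x|) ^ n := by
  have hC : 0 ≤ C := (abs_nonneg _).trans (hr 0)
  induction n generalizing r s x with
  | zero => simp [iterInt_zero]
  | succ n ih =>
    have hb : ‖∫ y in (0 : ℝ)..x, iterInt s r n y * r y‖ ≤
        |∫ y in (0 : ℝ)..x, (C ^ (n + 1)) * |y| ^ n| := by
      refine intervalIntegral.norm_integral_le_abs_of_norm_le ?_ ?_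
      · refine .of_forall fun y => ?_
        rw [norm_mul, Real.norm_eq_abs, Real.norm_eq_abs]
        calc _ ≤ (C * |y|) ^ n * C := by
              gcongr
              · exact ih hs hr y
              · exact hr y
          _ = _ := by rw [mul_pow]; ring
      · exact (by fun_prop : Continuous fun y : ℝ => C ^ (n + 1) * |y| ^ n).intervalIntegrable _ _
    have hi : |∫ y in (0 : ℝ)..x, |y| ^ n| = |x| ^ (n + 1) / (n + 1) := by
      have h := integral_pow_abs_sub_uIoc (a := 0) (b := x) n
      simp only [sub_zero] at h
      rw [intervalIntegral.abs_integral_eq_abs_integral_uIoc, h, abs_of_nonneg (by positivity)]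
    rw [intervalIntegral.integral_const_mul, abs_mul, abs_of_nonneg (by positivity : 0 ≤ C ^ (n + 1)),
      hi] at hb
    rw [iterInt_succ, abs_mul, abs_of_nonneg (by positivity : (0 : ℝ) ≤ n + 1)]
    calc _ ≤ ((n : ℝ) + 1) * (C ^ (n + 1) * (|x| ^ (n + 1) / (n + 1))) := by gcongr; exact hb
      _ = _ := by rw [mul_pow]; field_simp

/-- The solution with initial value `1` of the first component of the system
`Y' = i lam r Z`, `Z' = i lam s Y`. -/
def spectralSeries (r s : ℝ → ℝ) (lam : ℂ) (x : ℝ) : ℂ :=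
  ∑' k : ℕ, (Complex.I * lam) ^ k / (k.factorial : ℂ) * (iterInt r s k x : ℂ)

theorem summable_spectralSeries {r s : ℝ → ℝ} {C : ℝ} (hr : ∀ x, |r x| ≤ C) (hs : ∀ x, |s x| ≤ C)
    (lam : ℂ) (x : ℝ) :
    Summable fun k : ℕ => (Complex.I * lam) ^ k / (k.factorial : ℂ) * (iterInt r s k x : ℂ) := by
  refine .of_norm_bounded (Real.summable_pow_div_factorial (‖lam‖ * (C * |x|))) fun k => ?_
  rw [norm_mul, norm_div, norm_pow, norm_mul, Complex.norm_I, one_mul, Complex.norm_natCast,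
    Complex.norm_real, Real.norm_eq_abs, mul_pow, div_mul_eq_mul_div]
  gcongr
  exact abs_iterInt_le hr hs k x

theorem spectralSeries_at_zero (r s : ℝ → ℝ) (lam : ℂ) : spectralSeries r s lam 0 = 1 := by
  rw [spectralSeries, tsum_eq_single 0]
  · simp [iterInt_zero]
  · intro k hk
    obtain ⟨n, rfl⟩ := Nat.exists_eq_succ_of_ne_zero hk
    simp [iterInt_succ_at_zero]

/-- The derivative of term k + 1 is iλr times term k of the series with the weights exchanged. -/
theorem hasDerivAt_spectralSeries {r s : ℝ → ℝ} (hrc : Continuous r) (hsc : Continuous s) {C : ℝ}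
    (hr : ∀ x, |r x| ≤ C) (hs : ∀ x, |s x| ≤ C) (lam : ℂ) (x : ℝ) :
    HasDerivAt (spectralSeries r s lam) (Complex.I * lam * r x * spectralSeries s r lam x) x := by
  have hC : 0 ≤ C := (abs_nonneg _).trans (hr 0)
  have hfac : ∀ k : ℕ, (k.factorial : ℂ) ≠ 0 := fun k => mod_cast k.factorial_ne_zero
  have hk1 : ∀ k : ℕ, (k : ℂ) + 1 ≠ 0 := fun k => mod_cast k.succ_ne_zero
  have hsplit : spectralSeries r s lam = fun y => 1 + ∑' k : ℕ,
      (Complex.I * lam) ^ (k + 1) / ((k + 1).factorial : ℂ) * (iterInt r s (k + 1) y : ℂ) := by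
    ext y
    rw [spectralSeries, (summable_spectralSeries hr hs lam y).tsum_eq_zero_add]
    simp [iterInt_zero]
  have hd : ∀ (k : ℕ) (y : ℝ), HasDerivAt (fun y => (Complex.I * lam) ^ (k + 1) /
      ((k + 1).factorial : ℂ) * (iterInt r s (k + 1) y : ℂ))
      (Complex.I * lam * r y * ((Complex.I * lam) ^ k / (k.factorial : ℂ) * iterInt s r k y)) y := by
    intro k y
    have h := (hasDerivAt_iterInt_succ hrc hsc k y).ofReal_comp.const_mul
      ((Complex.I * lam) ^ (k + 1) / ((k + 1).factorial : ℂ))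
    refine h.congr_deriv ?_
    rw [Nat.factorial_succ]
    have := hfac k
    have := hk1 k
    push_cast
    field_simp
    ring
  rw [hsplit]
  -- The ball contains `x`, where the derivative is wanted, and 0, where all terms of positive index
  -- vanish and convergence is trivial.
  have hx0 : (0 : ℝ) ∈ Metric.ball (0 : ℝ) (|x| + 1) := by simp; positivity
  have hxx : x ∈ Metric.ball (0 : ℝ) (|x| + 1) := by simp
  have h := hasDerivAt_tsum_of_isPreconnected (t := Metric.ball (0 : ℝ) (|x| + 1))
    (((Real.summable_pow_div_factorial (‖lam‖ * (C * (|x| + 1)))).mul_left (‖lam‖ * C)))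
    Metric.isOpen_ball (convex_ball _ _).isPreconnected (fun k y _ => hd k y) (fun k y hy => ?_)
    hx0 ?_ hxx
  · rw [tsum_mul_left] at h
    exact h.const_add 1
  · rw [norm_mul, norm_mul, norm_mul, norm_mul, norm_div, norm_pow, norm_mul, Complex.norm_I,
      one_mul, Complex.norm_natCast, Complex.norm_real, Complex.norm_real, Real.norm_eq_abs,
      Real.norm_eq_abs, mul_pow ‖lam‖, div_mul_eq_mul_div]
    have hy' : |y| ≤ |x| + 1 := by simpa using (Metric.mem_ball.mp hy).le
    have h1 := (abs_iterInt_le hs hr k y).trans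
      (pow_le_pow_left₀ (by positivity) (mul_le_mul_of_nonneg_left hy' hC) k)
    gcongr
    exact hr y
  · simp only [iterInt_succ_at_zero]
    simp

end MaxwellNSBF

end

/-! ### Superpositions of waves, the variable ξ, and existence -/

noncomputable section
namespace MaxwellNSBF
open Set

/-- A superposition of monochromatic waves with frequencies `lam m` and amplitudes `c₁ m`, `c₂ m`. -/
def modeSum (r s : ℝ → ℝ) (S : Finset ℤ) (lam c₁ c₂ : ℤ → ℂ) (ξ t : ℝ) : ℂ :=
  ∑ m ∈ S, Complex.exp (Complex.I * lam m * t) *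
    (c₁ m * spectralSeries r s (lam m) ξ + c₂ m * spectralSeries r s (-lam m) ξ)

/-- The time derivative of `modeSum`. -/
def modeSumDt (r s : ℝ → ℝ) (S : Finset ℤ) (lam c₁ c₂ : ℤ → ℂ) (ξ t : ℝ) : ℂ :=
  ∑ m ∈ S, Complex.exp (Complex.I * lam m * t) * (Complex.I * lam m) *
    (c₁ m * spectralSeries r s (lam m) ξ + c₂ m * spectralSeries r s (-lam m) ξ)

theorem modeSum_at_zero (r s : ℝ → ℝ) (S : Finset ℤ) (lam c₁ c₂ : ℤ → ℂ) (t : ℝ) :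
    modeSum r s S lam c₁ c₂ 0 t =
      ∑ m ∈ S, (c₁ m + c₂ m) * Complex.exp (Complex.I * lam m * t) := by
  simp only [modeSum, spectralSeries_at_zero]
  refine Finset.sum_congr rfl fun m _ => by ring

theorem hasDerivAt_modeSum_time (r s : ℝ → ℝ) (S : Finset ℤ) (lam c₁ c₂ : ℤ → ℂ) (ξ t : ℝ) :
    HasDerivAt (fun τ => modeSum r s S lam c₁ c₂ ξ τ) (modeSumDt r s S lam c₁ c₂ ξ t) t := by
  unfold modeSum modeSumDt
  refine HasDerivAt.fun_sum fun m _ => ?_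
  have h1 : HasDerivAt (fun τ : ℝ => Complex.I * lam m * (τ : ℂ)) (Complex.I * lam m) t := by
    simpa using (hasDerivAt_id t).ofReal_comp.const_mul (Complex.I * lam m)
  exact h1.cexp.mul_const _

/-- Differentiation in ξ yields the factors ±iλ, with the sign of the spectral parameter. Up to the
sign of `c₂` this is a time derivative with the weights exchanged, which couples the two fields. -/
theorem hasDerivAt_modeSum_space {r s : ℝ → ℝ} (hrc : Continuous r) (hsc : Continuous s) {C : ℝ}
    (hr : ∀ x, |r x| ≤ C) (hs : ∀ x, |s x| ≤ C) (S : Finset ℤ) (lam c₁ c₂ : ℤ → ℂ) (ξ t : ℝ) :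
    HasDerivAt (fun η => modeSum r s S lam c₁ c₂ η t)
      (r ξ * modeSumDt s r S lam c₁ (fun m => -c₂ m) ξ t) ξ := by
  unfold modeSum modeSumDt
  rw [Finset.mul_sum]
  refine HasDerivAt.fun_sum fun m _ => ?_
  have h := (((hasDerivAt_spectralSeries hrc hsc hr hs (lam m) ξ).const_mul (c₁ m)).add
    ((hasDerivAt_spectralSeries hrc hsc hr hs (-lam m) ξ).const_mul (c₂ m))).const_mul
      (Complex.exp (Complex.I * lam m * t))
  refine h.congr_deriv ?_
  ring

theorem contDiff_spectralSeries {r s : ℝ → ℝ} (hrc : Continuous r) (hsc : Continuous s) {C : ℝ}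
    (hr : ∀ x, |r x| ≤ C) (hs : ∀ x, |s x| ≤ C) (lam : ℂ) :
    ContDiff ℝ 1 (spectralSeries r s lam) := by
  rw [contDiff_one_iff_deriv]
  have h := hasDerivAt_spectralSeries hrc hsc hr hs lam
  have h' := hasDerivAt_spectralSeries hsc hrc hs hr lam
  refine ⟨fun x => (h x).differentiableAt, ?_⟩
  rw [funext fun x => (h x).deriv]
  have : Continuous (spectralSeries s r lam) :=
    continuous_iff_continuousAt.mpr fun x => (h' x).continuousAt
  fun_prop

theorem contDiff_modeSum {r s : ℝ → ℝ} (hrc : Continuous r) (hsc : Continuous s) {C : ℝ}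
    (hr : ∀ x, |r x| ≤ C) (hs : ∀ x, |s x| ≤ C) (S : Finset ℤ) (lam c₁ c₂ : ℤ → ℂ)
    {ξ : ℝ → ℝ} (hξ : ContDiff ℝ 1 ξ) :
    ContDiff ℝ 1 fun p : ℝ × ℝ => modeSum r s S lam c₁ c₂ (ξ p.1) p.2 := by
  unfold modeSum
  refine ContDiff.sum fun m _ => ?_
  have h1 : ∀ l : ℂ, ContDiff ℝ 1 fun p : ℝ × ℝ => spectralSeries r s l (ξ p.1) := fun l =>
    (contDiff_spectralSeries hrc hsc hr hs l).comp (hξ.comp contDiff_fst)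
  have h2 : ContDiff ℝ 1 fun p : ℝ × ℝ => (p.2 : ℂ) :=
    Complex.ofRealCLM.contDiff.comp contDiff_snd
  have h3 : ContDiff ℝ 1 fun p : ℝ × ℝ => Complex.exp (Complex.I * lam m * (p.2 : ℂ)) :=
    (contDiff_const.mul h2).cexp
  exact h3.mul ((contDiff_const.mul (h1 _)).add (contDiff_const.mul (h1 _)))

/-- Extending ε by its boundary values makes ξ a C¹ bijection of the line, so existence needs no
one-sided derivatives. The extension need only be continuous. -/
theorem exists_continuous_extension {L : ℝ} (hL : 0 < L) {ε : ℝ → ℝ}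
    (hε : ContinuousOn ε (Icc 0 L)) (hεpos : ∀ x ∈ Icc 0 L, 0 < ε x) :
    ∃ e : ℝ → ℝ, Continuous e ∧ EqOn e ε (Icc 0 L) ∧
      ∃ δ Δ : ℝ, 0 < δ ∧ ∀ x, δ ≤ e x ∧ e x ≤ Δ := by
  have hne : (Icc (0 : ℝ) L).Nonempty := nonempty_Icc.mpr hL.le
  obtain ⟨a, ha, hmin⟩ := isCompact_Icc.exists_isMinOn hne hε
  obtain ⟨b, hb, hmax⟩ := isCompact_Icc.exists_isMaxOn hne hε
  refine ⟨IccExtend hL.le fun y : Icc 0 L => ε y,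
    (continuousOn_iff_continuous_domRestrict.mp hε).Icc_extend', ?_, ε a, ε b,
    hεpos a ha, fun x => ⟨?_, ?_⟩⟩
  · intro x hx
    rw [IccExtend_of_mem _ _ hx]
  · exact hmin (projIcc 0 L hL.le x).2
  · exact hmax (projIcc 0 L hL.le x).2

theorem xiOf_congr {μ L : ℝ} {e ε : ℝ → ℝ} (h : EqOn e ε (Icc 0 L)) {x : ℝ} (hx : x ∈ Icc 0 L) :
    xiOf μ ε x = xiOf μ e x := by
  unfold xiOf
  congr 1
  refine intervalIntegral.integral_congr fun y hy => ?_
  rw [uIcc_of_le hx.1] at hy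
  simp only [h ⟨hy.1, hy.2.trans hx.2⟩]

theorem xiOf_zero (μ : ℝ) (ε : ℝ → ℝ) : xiOf μ ε 0 = 0 := by simp [xiOf]

theorem hasDerivAt_xiOf (μ : ℝ) {e : ℝ → ℝ} (he : Continuous e) (x : ℝ) :
    HasDerivAt (xiOf μ e) (√μ * √(e x)) x := by
  have hc : Continuous fun y => √(e y) := by fun_prop
  exact (intervalIntegral.integral_hasDerivAt_right (hc.intervalIntegrable 0 x)
    (hc.stronglyMeasurableAtFilter _ _) hc.continuousAt).const_mul _

theorem contDiff_xiOf (μ : ℝ) {e : ℝ → ℝ} (he : Continuous e) : ContDiff ℝ 1 (xiOf μ e) := by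
  rw [contDiff_one_iff_deriv]
  refine ⟨fun x => (hasDerivAt_xiOf μ he x).differentiableAt, ?_⟩
  rw [funext fun x => (hasDerivAt_xiOf μ he x).deriv]
  fun_prop

theorem strictMono_xiOf {μ : ℝ} (hμ : 0 < μ) {e : ℝ → ℝ} (he : Continuous e)
    (hpos : ∀ x, 0 < e x) : StrictMono (xiOf μ e) :=
  strictMono_of_hasDerivAt_pos (fun x => hasDerivAt_xiOf μ he x)
    fun x => mul_pos (Real.sqrt_pos.mpr hμ) (Real.sqrt_pos.mpr (hpos x))

theorem surjective_xiOf {μ : ℝ} (hμ : 0 < μ) {e : ℝ → ℝ} (he : Continuous e) {δ : ℝ}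
    (hδ : 0 < δ) (hpos : ∀ x, δ ≤ e x) : Function.Surjective (xiOf μ e) := by
  set k := √μ * √δ with hk
  have hkpos : 0 < k := mul_pos (Real.sqrt_pos.mpr hμ) (Real.sqrt_pos.mpr hδ)
  -- The slope of ξ is at least k > 0, so comparison with the line kx gives both limits at infinity.
  have hmono : Monotone fun x => xiOf μ e x - k * x := by
    refine monotone_of_hasDerivAt_nonneg
      (fun x => (hasDerivAt_xiOf μ he x).sub ((hasDerivAt_id x).const_mul k)) fun x => ?_
    have : √δ ≤ √(e x) := Real.sqrt_le_sqrt (hpos x)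
    have := mul_le_mul_of_nonneg_left this (Real.sqrt_nonneg μ)
    simp only [Pi.zero_apply, mul_one]
    linarith
  have hc : Continuous (xiOf μ e) := (contDiff_xiOf μ he).continuous
  refine hc.surjective ?_ ?_
  · refine Filter.tendsto_atTop_mono' _ ?_ (Filter.tendsto_id.const_mul_atTop hkpos)
    filter_upwards [Filter.eventually_ge_atTop 0] with x hx
    have := hmono hx
    simp only [xiOf_zero, mul_zero, sub_zero] at this
    simpa using this
  · refine Filter.tendsto_atBot_mono' _ ?_ (Filter.tendsto_id.const_mul_atBot hkpos)
    filter_upwards [Filter.eventually_le_atBot 0] with x hx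
    have := hmono hx
    simp only [xiOf_zero, mul_zero, sub_zero] at this
    simpa using this

/-- Superpositions of monochromatic waves solve the Maxwell system. -/
theorem isSolution_modeSum {μ L : ℝ} {ε e : ℝ → ℝ} (he : Continuous e)
    (heq : EqOn e ε (Icc 0 L)) {r s : ℝ → ℝ} (hrc : Continuous r) (hsc : Continuous s) {C : ℝ}
    (hr : ∀ x, |r x| ≤ C) (hs : ∀ x, |s x| ≤ C) {p q : ℝ}
    (hE : ∀ x ∈ Icc 0 L, √μ * √(e x) * s (xiOf μ e x) * q = e x * p)
    (hH : ∀ x ∈ Icc 0 L, √μ * √(e x) * r (xiOf μ e x) * p = μ * q)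
    (I : Set ℝ) (S : Finset ℤ) (lam c₁ c₂ : ℤ → ℂ) :
    IsSolution μ ε L I
      (fun t => p * ∑ m ∈ S, (c₁ m + c₂ m) * Complex.exp (Complex.I * lam m * t))
      (fun t => -(Complex.I * q) * ∑ m ∈ S, (c₁ m - c₂ m) * Complex.exp (Complex.I * lam m * t))
      (fun x t => p * modeSum r s S lam c₁ c₂ (xiOf μ e x) t)
      (fun x t => -(Complex.I * q) * modeSum s r S lam c₁ (fun m => -c₂ m) (xiOf μ e x) t) := by
  have hξ := contDiff_xiOf μ he
  have cE : ContDiff ℝ 1 fun z : ℝ × ℝ => (p : ℂ) * modeSum r s S lam c₁ c₂ (xiOf μ e z.1) z.2 :=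
    contDiff_const.mul (contDiff_modeSum hrc hsc hr hs S lam c₁ c₂ hξ)
  have cH : ContDiff ℝ 1 fun z : ℝ × ℝ => -(Complex.I * q) *
      modeSum s r S lam c₁ (fun m => -c₂ m) (xiOf μ e z.1) z.2 :=
    contDiff_const.mul (contDiff_modeSum hsc hrc hs hr S lam c₁ _ hξ)
  have hx : ∀ x t : ℝ, (x, t) ∈ interior (domain μ ε L I) → x ∈ Icc 0 L := fun x t h =>
    (interior_subset h).1
  refine ⟨cE.continuous.continuousOn, cH.continuous.continuousOn, cE.contDiffOn, cH.contDiffOn,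
    fun x t h => ?_, fun x t h => ?_, fun t _ => ?_, fun t _ => ?_⟩
  -- The chain rule contributes the slope √μ √e of ξ. `hE`, and `hH` for the second equation, say
  -- that this slope, the weight and the amplitudes `p`, `q` combine to the coefficient in the
  -- system.
  · have h1 := ((hasDerivAt_modeSum_time r s S lam c₁ c₂ (xiOf μ e x) t).const_mul (p : ℂ)).deriv
    have h2 := (((hasDerivAt_modeSum_space hsc hrc hs hr S lam c₁ (fun m => -c₂ m)
      (xiOf μ e x) t).scomp x (hasDerivAt_xiOf μ he x)).const_mul (-(Complex.I * q))).deriv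
    have h3 := congrArg (fun y : ℝ => (y : ℂ)) (hE x (hx x t h))
    simp only [Function.comp_def, neg_neg, Complex.real_smul] at h1 h2 h3
    rw [h1, h2, ← heq (hx x t h)]
    push_cast at h3 ⊢
    linear_combination -modeSumDt r s S lam c₁ c₂ (xiOf μ e x) t * h3 + (√μ * √(e x) *
      s (xiOf μ e x) * q * modeSumDt r s S lam c₁ c₂ (xiOf μ e x) t : ℂ) * Complex.I_sq
  · have h1 := ((hasDerivAt_modeSum_time s r S lam c₁ (fun m => -c₂ m) (xiOf μ e x) t).const_mul
      (-(Complex.I * q))).deriv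
    have h2 := (((hasDerivAt_modeSum_space hrc hsc hr hs S lam c₁ c₂
      (xiOf μ e x) t).scomp x (hasDerivAt_xiOf μ he x)).const_mul (p : ℂ)).deriv
    have h3 := congrArg (fun y : ℝ => (y : ℂ)) (hH x (hx x t h))
    simp only [Function.comp_def, Complex.real_smul] at h1 h2 h3
    rw [h1, h2]
    push_cast at h3 ⊢
    linear_combination Complex.I * modeSumDt s r S lam c₁ (fun m => -c₂ m) (xiOf μ e x) t * h3
  · simp only [xiOf_zero, modeSum_at_zero]
  · simp only [xiOf_zero, modeSum_at_zero, sub_eq_add_neg]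

end MaxwellNSBF

end

/-! ### Uniqueness by characteristics -/

noncomputable section
namespace MaxwellNSBF
open Set Filter Topology

/-- The weight e^{2Qy} has derivative 2Q e^{2Qy}, so integrating Q N e^{2Qy} gains the factor 1/2.
The derivative is known only in the open interval; hence the estimate starts at δ > 0 and δ tends to
0. -/
theorem norm_le_of_norm_deriv_le_exp {g g' : ℝ → ℂ} {x Q N : ℝ} (hx : 0 < x)
    (hg : ContinuousOn g (Icc 0 x)) (hg0 : g 0 = 0) (hN : 0 ≤ N)
    (hd : ∀ y ∈ Ioo 0 x, HasDerivAt g (g' y) y)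
    (hb : ∀ y ∈ Ioo 0 x, ‖g' y‖ ≤ Q * (N * Real.exp (2 * Q * y))) :
    ‖g x‖ ≤ N / 2 * Real.exp (2 * Q * x) := by
  have key : ∀ δ ∈ Ioo 0 x, ‖g x‖ ≤ ‖g δ‖ + N / 2 * Real.exp (2 * Q * x) := by
    intro δ hδ
    have hB : ∀ y : ℝ, HasDerivAt (fun y => ‖g δ‖ + N / 2 *
        (Real.exp (2 * Q * y) - Real.exp (2 * Q * δ))) (Q * (N * Real.exp (2 * Q * y))) y := by
      intro y
      have h1 : HasDerivAt (fun y : ℝ => 2 * Q * y) (2 * Q) y := by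
        simpa using (hasDerivAt_id y).const_mul (2 * Q)
      refine (((h1.exp.sub_const (Real.exp (2 * Q * δ))).const_mul (N / 2)).const_add
        ‖g δ‖).congr_deriv ?_
      ring
    have h := image_norm_le_of_norm_deriv_right_le_deriv_boundary (a := δ) (b := x)
      (hg.mono (Icc_subset_Icc_left hδ.1.le))
      (fun y hy => (hd y ⟨hδ.1.trans_le hy.1, hy.2⟩).hasDerivWithinAt) (by simp) hB
      (fun y hy => hb y ⟨hδ.1.trans_le hy.1, hy.2⟩) (right_mem_Icc.mpr hδ.2.le)
    refine h.trans ?_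
    have := mul_nonneg (half_pos (zero_lt_two' ℝ)).le
      (mul_nonneg hN (Real.exp_nonneg (2 * Q * δ)))
    linarith
  have ht : Tendsto (fun δ => ‖g δ‖ + N / 2 * Real.exp (2 * Q * x)) (𝓝[>] 0)
      (𝓝 (‖g 0‖ + N / 2 * Real.exp (2 * Q * x))) := by
    refine Tendsto.add ?_ tendsto_const_nhds
    refine ((hg 0 (left_mem_Icc.mpr hx.le)).mono_left ?_).norm
    rw [← nhdsWithin_Ioo_eq_nhdsGT hx]
    exact nhdsWithin_mono _ Ioo_subset_Icc_self
  have := ge_of_tendsto ht (by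
    filter_upwards [Ioo_mem_nhdsGT hx] with δ hδ using key δ hδ)
  simpa [hg0] using this

theorem hasDerivAt_along_graph {F : ℝ → ℝ → ℂ} {y : ℝ} {γ : ℝ → ℝ} {v : ℝ}
    (hγ : HasDerivAt γ v y)
    (hF : DifferentiableAt ℝ (fun p : ℝ × ℝ => F p.1 p.2) (y, γ y)) :
    HasDerivAt (fun x => F x (γ x))
      (deriv (fun x => F x (γ y)) y + v * deriv (fun s => F y s) (γ y)) y := by
  set D := fderiv ℝ (fun p : ℝ × ℝ => F p.1 p.2) (y, γ y) with hD
  have hFD : HasFDerivAt (fun p : ℝ × ℝ => F p.1 p.2) D (y, γ y) := hF.hasFDerivAt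
  have h1 : HasDerivAt (fun x => F x (γ x)) (D (1, v)) y :=
    hFD.comp_hasDerivAt (f := fun x => (x, γ x)) y ((hasDerivAt_id' y).prodMk hγ)
  have h2 : HasDerivAt (fun x => F x (γ y)) (D (1, 0)) y :=
    hFD.comp_hasDerivAt (f := fun x => (x, γ y)) y
      ((hasDerivAt_id' y).prodMk (hasDerivAt_const y (γ y)))
  have h3 : HasDerivAt (fun s => F y s) (D (0, 1)) (γ y) :=
    hFD.comp_hasDerivAt (f := fun s => (y, s)) (γ y)
      ((hasDerivAt_const (γ y) y).prodMk (hasDerivAt_id' (γ y)))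
  rw [h2.deriv, h3.deriv]
  refine h1.congr_deriv ?_
  have : ((1 : ℝ), v) = (1, 0) + v • ((0 : ℝ), (1 : ℝ)) := by simp
  rw [this, map_add, map_smul, Complex.real_smul]

/-- The Riemann invariants `√ε E ± i √μ H`. -/
def riemannInvariant (μ : ℝ) (ε : ℝ → ℝ) (E H : ℝ → ℝ → ℂ) (σ x t : ℝ) : ℂ :=
  √(ε x) * E x t + σ * (Complex.I * (√μ * H x t))

section Uniqueness

variable {μ L : ℝ} {ε : ℝ → ℝ} {I : Set ℝ} {E₀ H₀ : ℝ → ℂ} {E H : ℝ → ℝ → ℂ}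

/-- The derivative of a Riemann invariant along its characteristic has no derivative of the
fields in it. -/
theorem IsSolution.hasDerivAt_riemannInvariant (h : IsSolution μ ε L I E₀ H₀ E H) (hμ : 0 < μ)
    {σ : ℝ} (hσ : σ ^ 2 = 1) {y ε' : ℝ} (hε' : HasDerivAt ε ε' y) (hpos : 0 < ε y)
    {γ : ℝ → ℝ} (hγ : HasDerivAt γ (-σ * (√μ * √(ε y))) y)
    (hmem : (y, γ y) ∈ interior (domain μ ε L I)) :
    HasDerivAt (fun x => riemannInvariant μ ε E H σ x (γ x))
      ((ε' / (2 * √(ε y)) : ℝ) * E y (γ y)) y := by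
  have hnhds := isOpen_interior.mem_nhds hmem
  have dE := hasDerivAt_along_graph hγ
    ((h.contDiffOn_E.differentiableOn one_ne_zero).differentiableAt hnhds)
  have dH := hasDerivAt_along_graph hγ
    ((h.contDiffOn_H.differentiableOn one_ne_zero).differentiableAt hnhds)
  have ds := (hε'.sqrt hpos.ne').ofReal_comp
  refine ((ds.mul dE).add ((((dH.const_mul (√μ : ℂ)).const_mul Complex.I)).const_mul
    (σ : ℂ))).congr_deriv ?_
  have m1 := h.maxwell_E y (γ y) hmem
  have m2 := h.maxwell_H y (γ y) hmem
  have e1 : (√μ : ℂ) ^ 2 = μ := mod_cast Real.sq_sqrt hμ.le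
  have e2 : (√(ε y) : ℂ) ^ 2 = ε y := mod_cast Real.sq_sqrt hpos.le
  have e3 : (σ : ℂ) ^ 2 = 1 := mod_cast hσ
  push_cast
  generalize deriv (fun x => E x (γ y)) y = Ex at *
  generalize deriv (fun x => H x (γ y)) y = Hx at *
  generalize deriv (fun s => E y s) (γ y) = Et at *
  generalize deriv (fun s => H y s) (γ y) = Ht at *
  -- Along dt/dx = -σ√(με), the E_x term cancels the H_t term because σ² = 1, and the H_x term
  -- cancels the E_t term.
  have m2' : Ex = Complex.I * μ * Ht := by
    linear_combination -Complex.I * m2 + Ex * Complex.I_sq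
  have m1' : Complex.I * Hx = ε y * Et := m1.symm
  rw [m2', ← e1]
  rw [← e2] at m1'
  linear_combination (σ : ℂ) * √μ * m1' - Complex.I * √μ ^ 2 * √(ε y) * Ht * e3

/-- Within the triangle cut off by the two characteristics through (x₀, t₀), every characteristic
followed back to x = 0 stays inside and starts from zero data. One integration halves any weighted
bound that holds for both invariants, so iterating forces them to vanish. -/
theorem IsSolution.eq_zero (h : IsSolution μ ε L I (fun _ => 0) (fun _ => 0) E H) (hμ : 0 < μ)
    (hL : 0 < L) (hε : ContDiffOn ℝ 1 ε (Icc 0 L)) (hεpos : ∀ x ∈ Icc 0 L, 0 < ε x)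
    {x₀ t₀ : ℝ} (hmem : (x₀, t₀) ∈ domain μ ε L I) : E x₀ t₀ = 0 ∧ H x₀ t₀ = 0 := by
  rcases hmem.1.1.eq_or_lt with hx0 | hx0
  · simp only at hx0
    subst hx0
    have : t₀ ∈ I := hmem.2 (by simp [xiOf_zero])
    exact ⟨h.initial_E t₀ this, h.initial_H t₀ this⟩
  simp only at hx0
  have hx0L : x₀ ≤ L := hmem.1.2
  obtain ⟨e, he, heq, δ, Δ, hδ, hbd⟩ := exists_continuous_extension hL hε.continuousOn hεpos
  have hepos : ∀ x, 0 < e x := fun x => hδ.trans_le (hbd x).1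
  set ξ := xiOf μ e
  have hξm : StrictMono ξ := strictMono_xiOf hμ he hepos
  have hξc : Continuous ξ := (contDiff_xiOf μ he).continuous
  have hξ0 : ξ 0 = 0 := xiOf_zero μ e
  have hTsub : ∀ y τ : ℝ, y ∈ Icc 0 x₀ → |τ - t₀| ≤ ξ x₀ - ξ y → (y, τ) ∈ domain μ ε L I := by
    intro y τ hy hτ
    have hyL : y ∈ Icc 0 L := ⟨hy.1, hy.2.trans hx0L⟩
    refine ⟨hyL, fun u hu => hmem.2 ?_⟩
    simp only [xiOf_congr heq hyL, xiOf_congr heq hmem.1] at hu ⊢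
    rw [abs_le] at hτ
    exact ⟨by linarith [hu.1], by linarith [hu.2]⟩
  -- The equations hold only in the interior of the domain, so the estimates run on the open
  -- triangle `O`. The closed triangle `T` supplies compactness for the initial bound and continuity
  -- up to x = 0.
  set O : Set (ℝ × ℝ) := {p | p.1 ∈ Ioo 0 x₀ ∧ |p.2 - t₀| < ξ x₀ - ξ p.1} with hO
  have hOopen : IsOpen O := by
    refine IsOpen.inter (isOpen_Ioo.preimage continuous_fst) ?_
    exact isOpen_lt (f := fun p : ℝ × ℝ => |p.2 - t₀|) (g := fun p : ℝ × ℝ => ξ x₀ - ξ p.1)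
      (by fun_prop) (by fun_prop)
  have hOint : O ⊆ interior (domain μ ε L I) :=
    interior_maximal (fun p hp => hTsub p.1 p.2 (Ioo_subset_Icc_self hp.1) hp.2.le) hOopen
  set T : Set (ℝ × ℝ) := {p | p.1 ∈ Icc 0 x₀ ∧ |p.2 - t₀| ≤ ξ x₀ - ξ p.1} with hT
  have hTdom : T ⊆ domain μ ε L I := fun p hp => hTsub p.1 p.2 hp.1 hp.2
  have hOT : O ⊆ T := fun p hp => ⟨Ioo_subset_Icc_self hp.1, hp.2.le⟩
  have hTcomp : IsCompact T := by
    refine IsCompact.of_isClosed_subset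
      ((isCompact_Icc (a := 0) (b := x₀)).prod (isCompact_Icc (a := t₀ - ξ x₀) (b := t₀ + ξ x₀))) ?_ ?_
    · refine IsClosed.inter (isClosed_Icc.preimage continuous_fst) ?_
      exact isClosed_le (f := fun p : ℝ × ℝ => |p.2 - t₀|) (g := fun p : ℝ × ℝ => ξ x₀ - ξ p.1)
        (by fun_prop) (by fun_prop)
    · rintro ⟨y, τ⟩ ⟨hy, hτ⟩
      simp only at hy hτ
      have : ξ 0 ≤ ξ y := hξm.monotone hy.1
      rw [abs_le] at hτ
      exact ⟨hy, by constructor <;> simp only <;> linarith⟩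
  set w := riemannInvariant μ ε E H with hw
  have hwc : ∀ σ, ContinuousOn (fun p : ℝ × ℝ => w σ p.1 p.2) T := by
    intro σ
    have c1 : ContinuousOn (fun p : ℝ × ℝ => (√(ε p.1) : ℂ)) T := by
      refine Complex.continuous_ofReal.comp_continuousOn (ContinuousOn.sqrt ?_)
      exact hε.continuousOn.comp continuous_fst.continuousOn fun p hp =>
        ⟨hp.1.1, hp.1.2.trans hx0L⟩
    have cE := h.continuousOn_E.mono hTdom
    have cH := h.continuousOn_H.mono hTdom
    simp only [hw, riemannInvariant]
    fun_prop
  -- (√ε)' E = (ε'/(2ε)) √ε E, so `Q` bounds the derivative of an invariant in terms of √ε E.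
  obtain ⟨Q, hQ⟩ : ∃ Q, ∀ y ∈ Icc 0 L, ‖derivWithin ε (Icc 0 L) y / (2 * ε y)‖ ≤ Q := by
    refine isCompact_Icc.exists_bound_of_continuousOn ?_
    refine (hε.continuousOn_derivWithin (uniqueDiffOn_Icc hL) le_rfl).div
      (continuousOn_const.mul hε.continuousOn) fun y hy => ?_
    exact (mul_pos two_pos (hεpos y hy)).ne'
  have hQ0 : 0 ≤ Q := (norm_nonneg _).trans (hQ 0 ⟨le_rfl, hL.le⟩)
  have step : ∀ N : ℝ, 0 ≤ N →
      (∀ σ ∈ ({1, -1} : Set ℝ), ∀ p ∈ O, ‖w σ p.1 p.2‖ ≤ N * Real.exp (2 * Q * p.1)) →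
      ∀ σ ∈ ({1, -1} : Set ℝ), ∀ p ∈ O, ‖w σ p.1 p.2‖ ≤ N / 2 * Real.exp (2 * Q * p.1) := by
    rintro N hN hwN σ hσ ⟨x, τ⟩ ⟨hx, hτ⟩
    simp only at hx hτ ⊢
    have hσ2 : σ ^ 2 = 1 := by rcases hσ with rfl | rfl <;> norm_num
    have hσa : |σ| = 1 := by rcases hσ with rfl | rfl <;> norm_num
    -- The characteristic through (x, τ): a straight line in the coordinates (ξ, t).
    set γ : ℝ → ℝ := fun y => τ + σ * (ξ x - ξ y) with hγ
    have hγx : γ x = τ := by simp [hγ]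
    have hγa : ∀ y, y ≤ x → |γ y - t₀| < ξ x₀ - ξ y := by
      intro y hy
      have h1 : |γ y - t₀| ≤ |τ - t₀| + |σ * (ξ x - ξ y)| := by
        rw [show γ y - t₀ = (τ - t₀) + σ * (ξ x - ξ y) by simp only [hγ]; ring]
        exact abs_add_le _ _
      rw [abs_mul, hσa, one_mul, abs_of_nonneg (sub_nonneg.mpr (hξm.monotone hy))] at h1
      linarith
    have hγO : ∀ y ∈ Ioc 0 x, (y, γ y) ∈ O := fun y hy =>
      ⟨⟨hy.1, hy.2.trans_lt hx.2⟩, hγa y hy.2⟩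
    have hγT : ∀ y ∈ Icc 0 x, (y, γ y) ∈ T := fun y hy =>
      ⟨⟨hy.1, hy.2.trans hx.2.le⟩, (hγa y hy.2).le⟩
    have hγc : Continuous γ := by fun_prop
    rw [← hγx]
    refine norm_le_of_norm_deriv_le_exp (g := fun y => w σ y (γ y))
      (g' := fun y => ((derivWithin ε (Icc 0 L) y / (2 * √(ε y)) : ℝ) : ℂ) * E y (γ y)) hx.1
      ?_ ?_ hN ?_ ?_
    · exact (hwc σ).comp (f := fun y => (y, γ y)) (by fun_prop) hγT
    · have h0 : γ 0 ∈ I := by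
        have h1 := (hTdom (hγT 0 ⟨le_rfl, hx.1.le⟩)).2
        simp only [xiOf_zero, sub_zero, add_zero] at h1
        exact h1 (by simp)
      simp [hw, riemannInvariant, h.initial_E _ h0, h.initial_H _ h0]
    · intro y hy
      have hyL : y ∈ Ioo 0 L := ⟨hy.1, (hy.2.trans hx.2).trans_le hx0L⟩
      have hyL' := Ioo_subset_Icc_self hyL
      refine h.hasDerivAt_riemannInvariant hμ hσ2 ?_ (hεpos y hyL') ?_ (hOint (hγO y ⟨hy.1, hy.2.le⟩))
      · exact ((hε.differentiableOn one_ne_zero) y hyL').hasDerivWithinAt.hasDerivAt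
          (Icc_mem_nhds hyL.1 hyL.2)
      · rw [← heq hyL']
        refine ((((hasDerivAt_xiOf μ he y).const_sub (ξ x)).const_mul σ).const_add τ).congr_deriv ?_
        ring
    · intro y hy
      have hyL : y ∈ Icc 0 L := ⟨hy.1.le, ((hy.2.trans hx.2).trans_le hx0L).le⟩
      have hyO := hγO y ⟨hy.1, hy.2.le⟩
      have hp := hwN 1 (by simp) _ hyO
      have hm := hwN (-1) (by simp) _ hyO
      simp only at hp hm
      have hs : 0 < √(ε y) := Real.sqrt_pos.mpr (hεpos y hyL)
      have hE : √(ε y) * ‖E y (γ y)‖ ≤ N * Real.exp (2 * Q * y) := by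
        -- √ε E is the mean of the two invariants, which is why both signs are estimated together.
        have h1 : 2 * (√(ε y) * E y (γ y)) = w 1 y (γ y) + w (-1) y (γ y) := by
          simp only [hw, riemannInvariant]
          push_cast
          ring
        have h2 := congrArg norm h1
        rw [norm_mul, norm_mul, Complex.norm_real, Real.norm_of_nonneg hs.le] at h2
        have h3 := norm_add_le (w 1 y (γ y)) (w (-1) y (γ y))
        rw [← h2] at h3
        norm_num at h3
        linarith
      have hsq : derivWithin ε (Icc 0 L) y / (2 * √(ε y)) =
          derivWithin ε (Icc 0 L) y / (2 * ε y) * √(ε y) := by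
        have := (hεpos y hyL).ne'
        have := Real.sq_sqrt (hεpos y hyL).le
        field_simp
        rw [this]
      rw [hsq, norm_mul, Complex.norm_real, norm_mul, Real.norm_of_nonneg hs.le, mul_assoc]
      exact mul_le_mul (hQ y hyL) hE (by positivity) hQ0
  obtain ⟨N₁, hN₁⟩ := hTcomp.exists_bound_of_continuousOn (hwc 1)
  obtain ⟨N₂, hN₂⟩ := hTcomp.exists_bound_of_continuousOn (hwc (-1))
  have hiter : ∀ n : ℕ, ∀ σ ∈ ({1, -1} : Set ℝ), ∀ p ∈ O,
      ‖w σ p.1 p.2‖ ≤ max 0 (max N₁ N₂) * (1 / 2) ^ n * Real.exp (2 * Q * p.1) := by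
    intro n
    induction n with
    | zero =>
      intro σ hσ p hp
      have h1 : ‖w σ p.1 p.2‖ ≤ max 0 (max N₁ N₂) := by
        rcases hσ with rfl | rfl
        · exact (hN₁ p (hOT hp)).trans (by simp)
        · exact (hN₂ p (hOT hp)).trans (by simp)
      have h2 : 1 ≤ Real.exp (2 * Q * p.1) := Real.one_le_exp (by
        have := hp.1.1; positivity)
      rw [pow_zero, mul_one]
      exact h1.trans (le_mul_of_one_le_right (le_max_left _ _) h2)
    | succ n ih =>
      have := step _ (by positivity) ih
      intro σ hσ p hp
      refine (this σ hσ p hp).trans_eq ?_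
      ring
  have hw0 : ∀ σ ∈ ({1, -1} : Set ℝ), ∀ p ∈ O, w σ p.1 p.2 = 0 := by
    intro σ hσ p hp
    have ht : Tendsto (fun n : ℕ => max 0 (max N₁ N₂) * (1 / 2) ^ n * Real.exp (2 * Q * p.1)) atTop
        (𝓝 (max 0 (max N₁ N₂) * 0 * Real.exp (2 * Q * p.1))) :=
      ((tendsto_pow_atTop_nhds_zero_of_lt_one (by norm_num) (by norm_num)).const_mul _).mul_const _
    have := ge_of_tendsto' ht fun n => hiter n σ hσ p hp
    simpa using this
  have hEH0 : ∀ p ∈ O, E p.1 p.2 = 0 ∧ H p.1 p.2 = 0 := by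
    intro p hp
    have h1 := hw0 1 (by simp) p hp
    have h2 := hw0 (-1) (by simp) p hp
    have hs : (√(ε p.1) : ℂ) ≠ 0 := mod_cast
      (Real.sqrt_pos.mpr (hεpos p.1 ⟨hp.1.1.le, hp.1.2.le.trans hx0L⟩)).ne'
    have hm : (√μ : ℂ) ≠ 0 := mod_cast (Real.sqrt_pos.mpr hμ).ne'
    simp only [hw, riemannInvariant] at h1 h2
    push_cast at h1 h2
    constructor
    · refine (mul_eq_zero.mp ?_).resolve_left hs
      linear_combination (h1 + h2) / 2
    · refine (mul_eq_zero.mp (?_ : Complex.I * √μ * H p.1 p.2 = 0)).resolve_left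
        (mul_ne_zero Complex.I_ne_zero hm)
      linear_combination (h1 - h2) / 2
  -- The apex (x₀, t₀) is not in `O`; it is reached by continuity along the segment t = t₀, y < x₀.
  have hzero : ∀ F : ℝ → ℝ → ℂ, ContinuousOn (fun p : ℝ × ℝ => F p.1 p.2) (domain μ ε L I) →
      (∀ p ∈ O, F p.1 p.2 = 0) → F x₀ t₀ = 0 := by
    intro F hF hF0
    have hyO : ∀ᶠ y in 𝓝[<] x₀, (y, t₀) ∈ O := by
      filter_upwards [Ioo_mem_nhdsLT hx0] with y hy
      exact ⟨hy, by simpa using hξm hy.2⟩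
    have h1 : Tendsto (fun y => (y, t₀)) (𝓝[<] x₀) (𝓝[domain μ ε L I] (x₀, t₀)) := by
      refine tendsto_nhdsWithin_iff.mpr ⟨?_, hyO.mono fun y hy => hTdom (hOT hy)⟩
      exact (Continuous.tendsto (by fun_prop) x₀).mono_left nhdsWithin_le_nhds
    have h2 := (hF (x₀, t₀) hmem).tendsto.comp h1
    refine tendsto_nhds_unique h2 (tendsto_const_nhds.congr' ?_)
    filter_upwards [hyO] with y hy using (hF0 _ hy).symm
  exact ⟨hzero E h.continuousOn_E fun p hp => (hEH0 p hp).1,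
    hzero H h.continuousOn_H fun p hp => (hEH0 p hp).2⟩

theorem IsSolution.sub {E' H' : ℝ → ℝ → ℂ} (h : IsSolution μ ε L I E₀ H₀ E H)
    (h' : IsSolution μ ε L I E₀ H₀ E' H') :
    IsSolution μ ε L I (fun _ => 0) (fun _ => 0) (fun x t => E x t - E' x t)
      (fun x t => H x t - H' x t) := by
  have dx : ∀ {F : ℝ → ℝ → ℂ}, ContDiffOn ℝ 1 (fun p : ℝ × ℝ => F p.1 p.2)
      (interior (domain μ ε L I)) → ∀ x t : ℝ, (x, t) ∈ interior (domain μ ε L I) →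
      DifferentiableAt ℝ (fun y => F y t) x ∧ DifferentiableAt ℝ (fun s => F x s) t := by
    intro F hF x t hxt
    have hd := (hF.differentiableOn one_ne_zero).differentiableAt (isOpen_interior.mem_nhds hxt)
    constructor
    · exact DifferentiableAt.comp x (f := fun y : ℝ => (y, t)) hd (by fun_prop)
    · exact DifferentiableAt.comp t (f := fun s : ℝ => (x, s)) hd (by fun_prop)
  refine ⟨h.continuousOn_E.sub h'.continuousOn_E, h.continuousOn_H.sub h'.continuousOn_H,
    h.contDiffOn_E.sub h'.contDiffOn_E, h.contDiffOn_H.sub h'.contDiffOn_H,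
    fun x t hxt => ?_, fun x t hxt => ?_, fun t ht => ?_, fun t ht => ?_⟩
  · rw [deriv_fun_sub (dx h.contDiffOn_E x t hxt).2 (dx h'.contDiffOn_E x t hxt).2,
      deriv_fun_sub (dx h.contDiffOn_H x t hxt).1 (dx h'.contDiffOn_H x t hxt).1]
    linear_combination h.maxwell_E x t hxt - h'.maxwell_E x t hxt
  · rw [deriv_fun_sub (dx h.contDiffOn_H x t hxt).2 (dx h'.contDiffOn_H x t hxt).2,
      deriv_fun_sub (dx h.contDiffOn_E x t hxt).1 (dx h'.contDiffOn_E x t hxt).1]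
    linear_combination h.maxwell_H x t hxt - h'.maxwell_H x t hxt
  · simp [h.initial_E t ht, h'.initial_E t ht]
  · simp [h.initial_H t ht, h'.initial_H t ht]

end Uniqueness

end MaxwellNSBF

end

/-! ### The formal powers φ_k, ψ_k and their Neumann series -/

noncomputable section
namespace MaxwellNSBF
open Set

/-- Choosing between X and X̃ by parity keeps the outermost weight fixed: f⁻² for the family of φ_k,
f² for that of ψ_k. The integrand of each family at k + 1 involves the other at k, so both are
treated in one induction. -/
theorem ite_X_Xtilde_eq_iterInt {f F : ℝ → ℝ} {Ξ : ℝ} (h : ∀ s ∈ Icc 0 Ξ, f s = F s) (k : ℕ) :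
    ∀ ξ ∈ Icc 0 Ξ,
      (if Odd k then X f k ξ else Xtilde f k ξ) =
        iterInt (fun s => (F s ^ 2)⁻¹) (fun s => F s ^ 2) k ξ ∧
      (if Odd k then Xtilde f k ξ else X f k ξ) =
        iterInt (fun s => F s ^ 2) (fun s => (F s ^ 2)⁻¹) k ξ := by
  induction k with
  | zero => intro ξ _; simp [X, Xtilde, iterInt_zero]
  | succ k ih =>
    intro ξ hξ
    have hsub : uIcc 0 ξ ⊆ Icc 0 Ξ := by
      rw [uIcc_of_le hξ.1]
      exact Icc_subset_Icc_right hξ.2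
    rw [iterInt_succ, iterInt_succ]
    rcases Nat.even_or_odd k with hk | hk
    · have hk' : ¬ Odd k := Nat.not_odd_iff_even.mpr hk
      rw [if_pos hk.add_one, if_pos hk.add_one, X, Xtilde, hk.neg_one_pow,
        hk.add_one.neg_one_pow]
      push_cast
      constructor
      · congr 1
        refine intervalIntegral.integral_congr fun s hs => ?_
        have := ih s (hsub hs)
        simp only [if_neg hk'] at this
        simp only [this.2, h s (hsub hs), zpow_neg_one]
      · congr 1
        refine intervalIntegral.integral_congr fun s hs => ?_
        have := ih s (hsub hs)
        simp only [if_neg hk'] at this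
        simp only [this.1, h s (hsub hs), zpow_one]
    · have hk' : ¬ Odd (k + 1) := Nat.not_odd_iff_even.mpr hk.add_one
      rw [if_neg hk', if_neg hk', X, Xtilde, hk.neg_one_pow, hk.add_one.neg_one_pow]
      push_cast
      constructor
      · congr 1
        refine intervalIntegral.integral_congr fun s hs => ?_
        have := ih s (hsub hs)
        simp only [if_pos hk] at this
        simp only [this.2, h s (hsub hs), zpow_neg_one]
      · congr 1
        refine intervalIntegral.integral_congr fun s hs => ?_
        have := ih s (hsub hs)
        simp only [if_pos hk] at this
        simp only [this.1, h s (hsub hs), zpow_one]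

theorem phi_eq_mul_iterInt {f F : ℝ → ℝ} {Ξ : ℝ} (h : ∀ s ∈ Icc 0 Ξ, f s = F s) (k : ℕ) {ξ : ℝ}
    (hξ : ξ ∈ Icc 0 Ξ) :
    phi f k ξ = F ξ * iterInt (fun s => (F s ^ 2)⁻¹) (fun s => F s ^ 2) k ξ := by
  rw [← (ite_X_Xtilde_eq_iterInt h k ξ hξ).1, phi, h ξ hξ, mul_ite]

theorem psi_eq_mul_iterInt {f F : ℝ → ℝ} {Ξ : ℝ} (h : ∀ s ∈ Icc 0 Ξ, f s = F s) (k : ℕ) {ξ : ℝ}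
    (hξ : ξ ∈ Icc 0 Ξ) :
    psi f k ξ = (F ξ)⁻¹ * iterInt (fun s => F s ^ 2) (fun s => (F s ^ 2)⁻¹) k ξ := by
  rw [← (ite_X_Xtilde_eq_iterInt h k ξ hξ).2, psi, h ξ hξ, mul_ite, div_eq_inv_mul, div_eq_inv_mul]

theorem exp_nat_mul_pi_div_two (n : ℕ) :
    Complex.exp (n * Real.pi * Complex.I / 2) = Complex.I ^ n := by
  rw [show (n : ℂ) * Real.pi * Complex.I / 2 = n * (Real.pi / 2 * Complex.I) by ring,
    Complex.exp_nat_mul, Complex.exp_pi_div_two_mul_I]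

/-- By the parity of j_n, the alternating series that multiplies c_m⁻ is the Neumann series at -λ.
-/
theorem neg_one_pow_mul_neumannTerm (d : ℕ → ℝ → ℝ) (lam : ℂ) (ξ : ℝ) (n : ℕ) :
    (-1) ^ n * neumannTerm d lam ξ n = neumannTerm d (-lam) ξ n := by
  rw [neumannTerm, neumannTerm, neg_mul, MaxwellLegendre.sphericalBesselJ_neg]
  ring

/-- The sum of the Neumann series whose coefficients come from a scaled family of iterated
integrals. -/
theorem hasSum_neumannTerm {r s : ℝ → ℝ} {C : ℝ} (hr : ∀ x, |r x| ≤ C) (hs : ∀ x, |s x| ≤ C)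
    {ξ a : ℝ} (hξ : 0 < ξ) {g : ℕ → ℝ} (hg : ∀ k, g k = a * iterInt r s k ξ)
    {d : ℕ → ℝ → ℝ}
    (hd : ∀ n : ℕ, d n ξ = (2 * (n : ℝ) + 1) / 2 *
      (∑ k ∈ Finset.range (n + 1), (legendre n).coeff k * g k / ξ ^ k - 1)) (lam : ℂ) :
    HasSum (neumannTerm d lam ξ)
      ((a * spectralSeries r s lam ξ - Complex.exp (Complex.I * lam * ξ)) / 2) := by
  have hC : 0 ≤ C := (abs_nonneg _).trans (hr 0)
  have hξ' : (ξ : ℂ) ≠ 0 := mod_cast hξ.ne'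
  -- Division by ξ^k cancels the growth of the iterated integrals in ξ and leaves the rate `C`.
  have hm : ∀ k, ‖((g k / ξ ^ k : ℝ) : ℂ)‖ ≤ |a| * C ^ k := by
    intro k
    have h := abs_iterInt_le hr hs k ξ
    rw [abs_of_pos hξ, mul_pow] at h
    rw [Complex.norm_real, Real.norm_eq_abs, hg, abs_div, abs_of_pos (pow_pos hξ k), abs_mul,
      div_le_iff₀ (pow_pos hξ k), mul_assoc]
    gcongr
  have h1 := MaxwellLegendre.hasSum_neumann hC hm (lam * ξ)
  have h2 := MaxwellLegendre.hasSum_neumann_exp (lam * ξ)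
  -- The exponential accounts for the -1 in the coefficients, and the 2 for their factor (2n+1)/2.
  have h3 := (h1.sub h2).div_const 2
  have e1 : ∑' k : ℕ, (Complex.I * (lam * ξ)) ^ k / (k.factorial : ℂ) * ((g k / ξ ^ k : ℝ) : ℂ) =
      a * spectralSeries r s lam ξ := by
    rw [spectralSeries, ← tsum_mul_left]
    congr 1
    ext k
    rw [hg, ← mul_assoc Complex.I, mul_pow (Complex.I * lam)]
    push_cast
    field_simp
  rw [e1, ← mul_assoc Complex.I] at h3
  suffices h : neumannTerm d lam ξ = fun n : ℕ => ((2 * (n : ℂ) + 1) *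
      MaxwellLegendre.momentFunctional (fun k => ((g k / ξ ^ k : ℝ) : ℂ)) (legendre n) *
        (Complex.I ^ n * sphericalBesselJ n (lam * ξ)) -
      (2 * (n : ℂ) + 1) * (Complex.I ^ n * sphericalBesselJ n (lam * ξ))) / 2 by
    rw [h]
    exact h3
  ext n
  rw [neumannTerm, exp_nat_mul_pi_div_two, hd,
    MaxwellLegendre.momentFunctional_apply _ (MaxwellLegendre.legendre_natDegree_le n)]
  push_cast
  simp only [mul_div_assoc]
  ring

theorem tilde_xiOf {μ L : ℝ} {ε : ℝ → ℝ} (hinj : InjOn (xiOf μ ε) (Icc 0 L)) {α : Type*}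
    (g : ℝ → α) {x : ℝ} (hx : x ∈ Icc 0 L) : tilde μ ε L g (xiOf μ ε x) = g x := by
  rw [tilde, hinj.leftInvOn_invFunOn hx]

/-- The profile extends to a continuous function on the line, bounded away from `0` and `∞`. -/
theorem exists_profile_extension {μ L : ℝ} (hμ : 0 < μ) (hL : 0 < L) {ε e : ℝ → ℝ}
    (he : Continuous e) (heq : EqOn e ε (Icc 0 L)) {δ Δ : ℝ} (hδ : 0 < δ)
    (hbd : ∀ x, δ ≤ e x ∧ e x ≤ Δ) :
    ∃ F : ℝ → ℝ, Continuous F ∧ (∀ s, 0 < F s) ∧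
      (∀ x, F (xiOf μ e x) = √(speed μ ε 0) / √(speed μ e x)) ∧
      ∃ C, ∀ s, |F s ^ 2| ≤ C ∧ |(F s ^ 2)⁻¹| ≤ C := by
  have hepos : ∀ x, 0 < e x := fun x => hδ.trans_le (hbd x).1
  have hspos : ∀ x, 0 < speed μ e x := fun x => by
    have := mul_pos (hepos x) hμ
    unfold speed
    positivity
  have h0 : speed μ ε 0 = speed μ e 0 := by
    rw [speed, speed, heq ⟨le_rfl, hL.le⟩]
  -- As an order isomorphism of the line, ξ has a continuous inverse, through which the speed
  -- becomes a function of ξ.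
  set φ : ℝ ≃o ℝ := StrictMono.orderIsoOfSurjective (xiOf μ e) (strictMono_xiOf hμ he hepos)
    (surjective_xiOf hμ he hδ fun x => (hbd x).1) with hφ
  have hφx : ∀ x, φ.symm (xiOf μ e x) = x := fun x => φ.symm_apply_apply x
  have hsc : Continuous (speed μ e) := by
    unfold speed
    refine continuous_const.div (by fun_prop) fun x => ?_
    exact (Real.sqrt_pos.mpr (mul_pos (hepos x) hμ)).ne'
  have hsq : ∀ x, (√(speed μ e 0) / √(speed μ e x)) ^ 2 = speed μ e 0 * √(e x * μ) := by
    intro x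
    rw [div_pow, Real.sq_sqrt (hspos 0).le, Real.sq_sqrt (hspos x).le]
    simp only [speed]
    rw [div_div_eq_mul_div, div_one]
  refine ⟨fun s => √(speed μ e 0) / √(speed μ e (φ.symm s)), ?_, fun s => ?_, fun x => ?_,
    max (speed μ e 0 * √(Δ * μ)) (speed μ e 0 * √(δ * μ))⁻¹, fun s => ⟨?_, ?_⟩⟩
  · refine continuous_const.div ?_ fun s => (Real.sqrt_pos.mpr (hspos _)).ne'
    exact Real.continuous_sqrt.comp (hsc.comp φ.symm.continuous)
  · have := hspos 0
    have := hspos (φ.symm s)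
    positivity
  · simp only [hφx, h0]
  · have := hspos 0
    simp only [hsq]
    rw [abs_of_nonneg (by positivity)]
    refine le_max_of_le_left ?_
    gcongr
    exact (hbd _).2
  · have := hspos 0
    simp only [hsq]
    rw [abs_of_nonneg (by positivity)]
    refine le_max_of_le_right ?_
    gcongr
    exact (hbd _).1

end MaxwellNSBF

end

/-! ### Assembly: the solution, its uniqueness and the representation -/

open MaxwellNSBF in
theorem theorem2 (μ : ℝ) (hμ : 0 < μ) (L : ℝ) (hL : 0 < L) (ε : ℝ → ℝ)
    (hε : ContDiffOn ℝ 1 ε (Set.Icc 0 L)) (hεpos : ∀ x ∈ Set.Icc 0 L, 0 < ε x)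
    (I : Set ℝ) (hI : I.OrdConnected)
    (M : ℕ) (ω₀ ω : ℂ) (α β : ℤ → ℂ) :
    ∃ E H : ℝ → ℝ → ℂ,
      IsSolution μ ε L I (modulated M ω₀ ω α) (modulated M ω₀ ω β) E H ∧
      (∀ E' H' : ℝ → ℝ → ℂ,
        IsSolution μ ε L I (modulated M ω₀ ω α) (modulated M ω₀ ω β) E' H' →
        ∀ x t : ℝ, (x, t) ∈ domain μ ε L I → E' x t = E x t ∧ H' x t = H x t) ∧
      ∀ ξ t : ℝ, 0 < ξ → ξ ≤ xiOf μ ε L → Set.Icc (t - ξ) (t + ξ) ⊆ I →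
        (∀ m ∈ Finset.Icc (-(M : ℤ)) M,
          Summable (neumannTerm (coeffA (profile μ ε L)) (freq ω₀ ω m) ξ) ∧
          Summable (fun n : ℕ =>
            (-1 : ℂ) ^ n * neumannTerm (coeffA (profile μ ε L)) (freq ω₀ ω m) ξ n) ∧
          Summable (neumannTerm (coeffB (profile μ ε L)) (freq ω₀ ω m) ξ) ∧
          Summable (fun n : ℕ =>
            (-1 : ℂ) ^ n * neumannTerm (coeffB (profile μ ε L)) (freq ω₀ ω m) ξ n)) ∧
        tilde μ ε L E ξ t =
          1 / (√(tilde μ ε L (speed μ ε) ξ * tilde μ ε L ε ξ) : ℂ) *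
          ∑ m ∈ Finset.Icc (-(M : ℤ)) M, Complex.exp (Complex.I * freq ω₀ ω m * t) *
            (cPlus μ ε α β m / 2 * Complex.exp (Complex.I * freq ω₀ ω m * ξ)
              + cMinus μ ε α β m / 2 * Complex.exp (-(Complex.I * freq ω₀ ω m * ξ))
              + cPlus μ ε α β m *
                ∑' n : ℕ, neumannTerm (coeffA (profile μ ε L)) (freq ω₀ ω m) ξ n
              + cMinus μ ε α β m *
                ∑' n : ℕ, (-1 : ℂ) ^ n *
                  neumannTerm (coeffA (profile μ ε L)) (freq ω₀ ω m) ξ n) ∧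
        tilde μ ε L H ξ t =
          -(Complex.I / (√(tilde μ ε L (speed μ ε) ξ * μ) : ℂ)) *
          ∑ m ∈ Finset.Icc (-(M : ℤ)) M, Complex.exp (Complex.I * freq ω₀ ω m * t) *
            (cPlus μ ε α β m / 2 * Complex.exp (Complex.I * freq ω₀ ω m * ξ)
              - cMinus μ ε α β m / 2 * Complex.exp (-(Complex.I * freq ω₀ ω m * ξ))
              + cPlus μ ε α β m *
                ∑' n : ℕ, neumannTerm (coeffB (profile μ ε L)) (freq ω₀ ω m) ξ n
              - cMinus μ ε α β m *
                ∑' n : ℕ, (-1 : ℂ) ^ n *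
                  neumannTerm (coeffB (profile μ ε L)) (freq ω₀ ω m) ξ n) := by
  obtain ⟨e, he, heq, δ, Δ, hδ, hbd⟩ := exists_continuous_extension hL hε.continuousOn hεpos
  have hepos : ∀ x, 0 < e x := fun x => hδ.trans_le (hbd x).1
  obtain ⟨F, hFc, hFpos, hFx, C, hC⟩ := exists_profile_extension hμ hL he heq hδ hbd
  have h0 : (0 : ℝ) ∈ Set.Icc 0 L := ⟨le_rfl, hL.le⟩
  have hmono := strictMono_xiOf hμ he hepos
  have hinj : Set.InjOn (xiOf μ ε) (Set.Icc 0 L) := by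
    intro x hx y hy hxy
    rw [xiOf_congr heq hx, xiOf_congr heq hy] at hxy
    exact hmono.injective hxy
  have hspeed : ∀ x ∈ Set.Icc 0 L, speed μ e x = speed μ ε x := fun x hx => by
    rw [speed, speed, heq hx]
  have hexists : ∀ ξ ∈ Set.Icc 0 (xiOf μ ε L), ∃ x ∈ Set.Icc 0 L, xiOf μ ε x = ξ := by
    intro ξ hξ
    obtain ⟨x, rfl⟩ := surjective_xiOf hμ he hδ (fun x => (hbd x).1) ξ
    have hx : x ∈ Set.Icc 0 L := by
      constructor
      · refine hmono.le_iff_le.mp ?_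
        rw [xiOf_zero]
        exact hξ.1
      · refine hmono.le_iff_le.mp ?_
        rw [← xiOf_congr heq ⟨hL.le, le_rfl⟩]
        exact hξ.2
    exact ⟨x, hx, xiOf_congr heq hx⟩
  have hprofile : ∀ s ∈ Set.Icc 0 (xiOf μ ε L), profile μ ε L s = F s := by
    intro s hs
    obtain ⟨x, hx, rfl⟩ := hexists s hs
    have h00 := tilde_xiOf hinj (speed μ ε) h0
    rw [xiOf_zero] at h00
    rw [profile, h00, tilde_xiOf hinj _ hx, xiOf_congr heq hx, hFx, hspeed x hx]
  set c₀ := speed μ ε 0 with hc₀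
  have hε0 : 0 < ε 0 := hεpos 0 h0
  have hc₀pos : 0 < c₀ := by
    have := mul_pos hε0 hμ
    rw [hc₀, speed]
    positivity
  have hrc : Continuous fun s => (F s ^ 2)⁻¹ :=
    (hFc.pow 2).inv₀ fun s => (pow_pos (hFpos s) 2).ne'
  have hsc : Continuous fun s => F s ^ 2 := hFc.pow 2
  have hr : ∀ s, |(F s ^ 2)⁻¹| ≤ C := fun s => (hC s).2
  have hs : ∀ s, |F s ^ 2| ≤ C := fun s => (hC s).1
  have hFsq : ∀ x, F (xiOf μ e x) ^ 2 = c₀ * (√(e x) * √μ) := by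
    intro x
    have hsp : 0 < speed μ e x := by
      have := mul_pos (hepos x) hμ
      rw [speed]
      positivity
    rw [hFx, div_pow, Real.sq_sqrt hc₀pos.le, Real.sq_sqrt hsp.le, speed, div_div_eq_mul_div,
      div_one, Real.sqrt_mul (hepos x).le]
  -- `p` and `q` undo the factors √(c(0)ε(0)) and √(c(0)μ) contained in c_m^±, so that the values at
  -- ξ = 0 are the prescribed data. Their relation `hpq`, which expresses c(0)² ε(0) μ = 1, makes
  -- both Maxwell equations hold.
  set p := 1 / √(c₀ * ε 0) with hp
  set q := 1 / √(c₀ * μ) with hq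
  have hpq : p = c₀ * μ * q := by
    have h1 : √(c₀ * μ) * √(c₀ * ε 0) = 1 := by
      rw [← Real.sqrt_mul (by positivity), Real.sqrt_eq_one, hc₀, speed]
      have h2 := Real.sq_sqrt (mul_pos hε0 hμ).le
      have h3 : √(ε 0 * μ) ≠ 0 := (Real.sqrt_pos.mpr (mul_pos hε0 hμ)).ne'
      field_simp
      linarith
    have h4 : √(c₀ * μ) ≠ 0 := (Real.sqrt_pos.mpr (mul_pos hc₀pos hμ)).ne'
    have h5 : √(c₀ * ε 0) ≠ 0 := (Real.sqrt_pos.mpr (mul_pos hc₀pos hε0)).ne'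
    have h6 := Real.sq_sqrt (mul_pos hc₀pos hμ).le
    rw [hp, hq]
    field_simp
    linear_combination -√(c₀ * μ) * h1 + √(c₀ * ε 0) * h6
  have hE : ∀ x ∈ Set.Icc 0 L, √μ * √(e x) * F (xiOf μ e x) ^ 2 * q = e x * p := by
    intro x _
    rw [hFsq, hpq]
    linear_combination (c₀ * q * √(e x) ^ 2) * Real.sq_sqrt hμ.le +
      c₀ * q * μ * Real.sq_sqrt (hepos x).le
  have hH : ∀ x ∈ Set.Icc 0 L, √μ * √(e x) * (F (xiOf μ e x) ^ 2)⁻¹ * p = μ * q := by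
    intro x _
    have h1 : √μ ≠ 0 := (Real.sqrt_pos.mpr hμ).ne'
    have h2 : √(e x) ≠ 0 := (Real.sqrt_pos.mpr (hepos x)).ne'
    rw [hFsq, hpq]
    field_simp
  set S := Finset.Icc (-(M : ℤ)) M with hS
  have hsol := isSolution_modeSum he heq hrc hsc hr hs hE hH I S (freq ω₀ ω)
    (fun m => cPlus μ ε α β m / 2) (fun m => cMinus μ ε α β m / 2)
  have hdataE : (fun t : ℝ => (p : ℂ) * ∑ m ∈ S, (cPlus μ ε α β m / 2 + cMinus μ ε α β m / 2) *
      Complex.exp (Complex.I * freq ω₀ ω m * t)) = modulated M ω₀ ω α := by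
    ext t
    rw [modulated, Finset.mul_sum]
    refine Finset.sum_congr rfl fun m _ => ?_
    have h1 : (√c₀ : ℂ) ≠ 0 := mod_cast (Real.sqrt_pos.mpr hc₀pos).ne'
    have h2 : (√(ε 0) : ℂ) ≠ 0 := mod_cast (Real.sqrt_pos.mpr hε0).ne'
    rw [cPlus, cMinus, hp, Real.sqrt_mul hc₀pos.le, ← hc₀]
    push_cast
    field_simp
    ring
  have hdataH : (fun t : ℝ => -(Complex.I * q) * ∑ m ∈ S,
      (cPlus μ ε α β m / 2 - cMinus μ ε α β m / 2) *
      Complex.exp (Complex.I * freq ω₀ ω m * t)) = modulated M ω₀ ω β := by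
    ext t
    rw [modulated, Finset.mul_sum]
    refine Finset.sum_congr rfl fun m _ => ?_
    have h1 : (√c₀ : ℂ) ≠ 0 := mod_cast (Real.sqrt_pos.mpr hc₀pos).ne'
    have h2 : (√μ : ℂ) ≠ 0 := mod_cast (Real.sqrt_pos.mpr hμ).ne'
    rw [cPlus, cMinus, hq, Real.sqrt_mul hc₀pos.le, ← hc₀]
    push_cast
    field_simp
    linear_combination -2 * (√μ : ℂ) * β m * Complex.I_sq
  rw [hdataE, hdataH] at hsol
  refine ⟨_, _, hsol, fun E' H' h' x t hxt => ?_, fun ξ t hξ hξL _ => ?_⟩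
  · have := (h'.sub hsol).eq_zero hμ hL hε hεpos hxt
    exact ⟨sub_eq_zero.mp this.1, sub_eq_zero.mp this.2⟩
  have hξmem : ξ ∈ Set.Icc 0 (xiOf μ ε L) := ⟨hξ.le, hξL⟩
  -- The sum is (F Y - e^{iλξ})/2. Added to half the exponential it leaves F Y/2, which is the term
  -- in the constructed solution up to the factor F.
  have hA : ∀ lam : ℂ, HasSum (neumannTerm (coeffA (profile μ ε L)) lam ξ) _ := fun lam =>
    hasSum_neumannTerm hr hs hξ (fun k => phi_eq_mul_iterInt hprofile k hξmem)
      (fun n => rfl) lam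
  have hB : ∀ lam : ℂ, HasSum (neumannTerm (coeffB (profile μ ε L)) lam ξ) _ := fun lam =>
    hasSum_neumannTerm hs hr hξ (fun k => psi_eq_mul_iterInt hprofile k hξmem)
      (fun n => rfl) lam
  simp only [neg_one_pow_mul_neumannTerm]
  refine ⟨fun m _ => ⟨(hA _).summable, (hA _).summable, (hB _).summable, (hB _).summable⟩, ?_⟩
  simp only [(hA _).tsum_eq, (hB _).tsum_eq]
  obtain ⟨x, hx, rfl⟩ := hexists ξ hξmem
  have hcx : 0 < speed μ ε x := by
    have := mul_pos (hεpos x hx) hμ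
    rw [speed]
    positivity
  have hcne : √(speed μ ε x) ≠ 0 := (Real.sqrt_pos.mpr hcx).ne'
  have hmne : √μ ≠ 0 := (Real.sqrt_pos.mpr hμ).ne'
  have hc0ne : √c₀ ≠ 0 := (Real.sqrt_pos.mpr hc₀pos).ne'
  have hFval : F (xiOf μ ε x) = √c₀ / √(speed μ ε x) := by
    rw [xiOf_congr heq hx, hFx, hspeed x hx]
  -- This is c²ε = 1/μ. Compared at x and at 0, it shows that p = F/√(cε), which turns the constant
  -- amplitude into the prefactor depending on ξ.
  have hsq : ∀ y ∈ Set.Icc 0 L, √(speed μ ε y) * √(speed μ ε y * ε y) = (√μ)⁻¹ := by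
    intro y hy
    have hy' := mul_pos (hεpos y hy) hμ
    have hsy : 0 ≤ speed μ ε y := by rw [speed]; positivity
    rw [← Real.sqrt_mul hsy, ← Real.sqrt_inv]
    congr 1
    have h2 := Real.sq_sqrt hy'.le
    have h3 : √(ε y * μ) ≠ 0 := (Real.sqrt_pos.mpr hy').ne'
    rw [speed]
    field_simp
    linarith
  have hpF : (p : ℂ) = 1 / (√(speed μ ε x * ε x) : ℂ) * F (xiOf μ ε x) := by
    have h1 := hsq x hx
    have h2 := hsq 0 h0
    rw [← hc₀] at h2
    have h3 : √(speed μ ε x * ε x) ≠ 0 := (Real.sqrt_pos.mpr (mul_pos hcx (hεpos x hx))).ne'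
    have h4 : √(c₀ * ε 0) ≠ 0 := (Real.sqrt_pos.mpr (mul_pos hc₀pos hε0)).ne'
    have h5 : p = 1 / √(speed μ ε x * ε x) * F (xiOf μ ε x) := by
      rw [hp, hFval]
      field_simp
      linarith
    rw [h5]
    push_cast
    rfl
  have hqF : (q : ℂ) = 1 / (√(speed μ ε x * μ) : ℂ) * (F (xiOf μ ε x))⁻¹ := by
    have h5 : q = 1 / √(speed μ ε x * μ) * (F (xiOf μ ε x))⁻¹ := by
      rw [hq, hFval, Real.sqrt_mul hcx.le, Real.sqrt_mul hc₀pos.le]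
      field_simp
    rw [h5]
    push_cast
    rfl
  rw [tilde_xiOf hinj _ hx, tilde_xiOf hinj _ hx, tilde_xiOf hinj _ hx, tilde_xiOf hinj _ hx]
  simp only [modeSum, ← xiOf_congr heq hx]
  rw [hpF, hqF]
  have hexp : ∀ lam : ℂ, Complex.I * -lam * (xiOf μ ε x : ℂ) =
      -(Complex.I * lam * (xiOf μ ε x : ℂ)) := fun lam => by ring
  constructor
  · rw [mul_assoc, Finset.mul_sum (a := (F (xiOf μ ε x) : ℂ))]
    congr 1
    refine Finset.sum_congr rfl fun m _ => ?_
    rw [hexp]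
    ring
  · rw [show -(Complex.I * (1 / (√(speed μ ε x * μ) : ℂ) * (((F (xiOf μ ε x))⁻¹ : ℝ) : ℂ))) =
      -(Complex.I / (√(speed μ ε x * μ) : ℂ)) * (((F (xiOf μ ε x))⁻¹ : ℝ) : ℂ) by ring, mul_assoc,
      Finset.mul_sum (a := (((F (xiOf μ ε x))⁻¹ : ℝ) : ℂ))]
    congr 1
    refine Finset.sum_congr rfl fun m _ => ?_
    rw [hexp]
    ring
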